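/- **Setting.** Let $G=(Y,Z,E)$ be a finite bipartite graph with a set $Y$ of ball types and a set $Z$ of bins, let $b\ge 1$ be an integer, and let $r_y\ge 0$ ($y\in Y$) be arbitrary rates, normalized so that $\sum_{y\in Y} r_y=b$. At each time $t=1,\dots,b$ a ball arrives whose type is chosen independently, equal to $y$ with probability $r_y/b$. A ball of type $y$ may be put into at most one bin adjacent to $y$ (or dropped), and each bin holds at most one ball. For every arrival sequence $\omega=(y_1,\dots,y_b)$ fix a maximum-size allocation of its balls, computed with full knowledge of $\omega$; let $\mathrm{OPT}(\omega)$ be its size and, for $(y,z)\in E$, let $F_{(y,z)}(\omega)\in\{0,1\}$ indicate whether it puts a ball of type $y$ into bin $z$. Let $f_{(y,z)}=\mathbb E[F_{(y,z)}(\omega)]$ be the resulting fractional matching. **Algorithm.** For each $y\in Y$ list its neighbours as $z_1,\dots,z_k$ with $f_{(y,z_1)}\ge\dots\ge f_{(y,z_k)}$ (ties broken arbitrarily). Up to endpoints, define two families of subintervals of $[0,r_y]$: - $I_{(y,z_l)}=\bigl[\sum_{j=1}^{l-1} f_{(y,z_j)},\ \sum_{j=1}^{l} f_{(y,z_j)}\bigr]$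 for $1\le l\le k$; - $J_{(y,z_1)}=[r_y-f_{(y,z_1)},\,r_y]$ and $J_{(y,z_l)}=\bigl[\sum_{j=2}^{l-1} f_{(y,z_j)},\ \sum_{j=2}^{l} f_{(y,z_j)}\bigr]$ for $2\le l\le k$. In each family the part of $[0,r_y]$ left uncovered is assigned to a dummy bin, which can never hold a ball. When a ball of type $y$ arrives, the algorithm draws a fresh $x$, uniform on $[0,r_y]$ and independent of everything else; its first-priority bin is the bin $z$ with $x\in I_{(y,z)}$ and its second-priority bin is the bin $z'$ with $x\in J_{(y,z')}$. If the first-priority bin is a real bin and is empty, the ball is put there. Otherwise (it is full, or is the dummy bin) the ball is put into the second-priority bin if that is a real bin and is empty, and is dropped if not. Let $\mathrm{ALG}$ be the number of nonempty bins after time $b$. **Theorem.** There is an absolute constant $b_0$ such that for every $b\ge b_0$, every finite bipartite graph $G$, all rates $r_y\ge 0$ with $\sum_{y} r_y=b$, every choice of the maximum allocations and every admissible ordering of the neighbours, if $\mathbb E[\mathrm{OPT}]>0$ then $$\frac{\mathbb E[\mathrm{ALG}]}{\mathbb E[\mathrm{OPT}]}\ \ge\ 0.702 .$$ -/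

import Mathlib

namespace OnlineMatching

open MeasureTheory

noncomputable section

variable {Y Z : Type*} {b : ℕ}

/-! ### Arrivals and the optimum offline allocation

The bipartite graph has ball types `Y`, bins `Z` and edge relation `Adj : Y → Z → Prop`.
A sequence of `b` arrivals is `ω : Fin b → Y`. An allocation of the balls of `ω` is
`M : Fin b → Option Z`: the `t`-th ball goes to the bin `z` if `M t = some z`, and it is dropped
if `M t = none`. -/

/-- The probability of `ω` when the balls are independent and each of them has type `y` with
probability proportional to `r y`. -/
def seqProb [Fintype Y] (r : Y → ℝ) (ω : Fin b → Y) : ℝ :=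
  ∏ t, r (ω t) / ∑ y, r y

/-- Every ball goes to an adjacent bin (or is dropped) and no bin receives two balls. -/
structure IsAllocation (Adj : Y → Z → Prop) (ω : Fin b → Y) (M : Fin b → Option Z) : Prop where
  adj : ∀ t z, M t = some z → Adj (ω t) z
  inj : ∀ s t z, M s = some z → M t = some z → s = t

/-- The number of balls that are allocated. -/
def allocSize (M : Fin b → Option Z) : ℕ :=
  (Finset.univ.filter fun t => (M t).isSome).card

/-- An allocation of maximum size, with the sequence `ω` known in advance. -/
structure IsMaxAllocation (Adj : Y → Z → Prop) (ω : Fin b → Y) (M : Fin b → Option Z) : Prop where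
  isAllocation : IsAllocation Adj ω M
  le_size : ∀ M', IsAllocation Adj ω M' → allocSize M' ≤ allocSize M

/-- The expected size of the optimum offline allocation `opt ω`. -/
def expectedOpt [Fintype Y] (r : Y → ℝ) (opt : (Fin b → Y) → Fin b → Option Z) : ℝ :=
  ∑ ω : Fin b → Y, seqProb r ω * allocSize (opt ω)

open Classical in
/-- The fractional matching defined by `opt`: the probability that a ball of type `y` is allocated
to the bin `z` by `opt`. -/
def fracMatching [Fintype Y] (r : Y → ℝ) (opt : (Fin b → Y) → Fin b → Option Z)
    (y : Y) (z : Z) : ℝ :=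
  ∑ ω : Fin b → Y, seqProb r ω * (if ∃ t, ω t = y ∧ opt ω t = some z then 1 else 0)

/-! ### The two partitions of the interval `[0, r y]`

Below `ρ` stands for `r y`, `φ z` for the value of the fractional matching at the edge `(y, z)`,
and `l` for the list `[z₁, …, z_k]` of the neighbours of `y`, in an order of nonincreasing `φ`.
Intervals are taken half-open; this affects only finitely many points. -/

/-- `l` lists the elements of `N` without repetition, in an order of nonincreasing `φ`. -/
structure IsDecreasingListing (N : Z → Prop) (φ : Z → ℝ) (l : List Z) : Prop where
  nodup : l.Nodup
  mem_iff : ∀ z, z ∈ l ↔ N z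
  sorted : l.Pairwise fun z z' => φ z' ≤ φ z

open Classical in
/-- The sum of `φ` over the entries of `l` that precede `z`. -/
def sumBefore (φ : Z → ℝ) (l : List Z) (z : Z) : ℝ :=
  ((l.takeWhile fun z' => decide (z' ≠ z)).map φ).sum

/-- The interval of `z` in the first partition: for `z = z_j`, from `φ z₁ + ⋯ + φ z_{j-1}` to
`φ z₁ + ⋯ + φ z_j`. -/
def intervalI (φ : Z → ℝ) (l : List Z) (z : Z) : Set ℝ :=
  Set.Ico (sumBefore φ l z) (sumBefore φ l z + φ z)

open Classical in
/-- The interval of `z` in the second partition: from `ρ - φ z₁` to `ρ` for `z = z₁`, and from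
`φ z₂ + ⋯ + φ z_{j-1}` to `φ z₂ + ⋯ + φ z_j` for `z = z_j` with `2 ≤ j`. -/
def intervalJ (ρ : ℝ) (φ : Z → ℝ) (l : List Z) (z : Z) : Set ℝ :=
  if l.head? = some z then Set.Ico (ρ - φ z) ρ
  else Set.Ico (sumBefore φ l.tail z) (sumBefore φ l.tail z + φ z)

open Classical in
/-- The first-priority bin for the number `x`. The value `none` stands for the dummy bin, whose
interval is the part of `[0, ρ]` that the intervals of the bins in `l` leave over. -/
def firstBin (φ : Z → ℝ) (l : List Z) (x : ℝ) : Option Z :=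
  l.find? fun z => decide (x ∈ intervalI φ l z)

open Classical in
/-- The second-priority bin for the number `x`; again `none` stands for the dummy bin. -/
def secondBin (ρ : ℝ) (φ : Z → ℝ) (l : List Z) (x : ℝ) : Option Z :=
  l.find? fun z => decide (x ∈ intervalJ ρ φ l z)

/-! ### The adaptive algorithm -/

open Classical in
/-- The set of full bins after one more ball, with first choice `c.1` and second choice `c.2`, when
`S` is the set of full bins before it: the ball goes to `c.1` if this is an empty bin; otherwise
(`c.1` is full, or is the dummy bin, which holds no balls) it goes to `c.2` if that is an empty bin,
and else it is dropped. -/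
def addBall (S : Finset Z) (c : Option Z × Option Z) : Finset Z :=
  if ∃ z, c.1 = some z ∧ z ∉ S then S ∪ c.1.toFinset else S ∪ c.2.toFinset

/-- The set of full bins after the first `n` balls, when the `t`-th ball has the choices `c t`. -/
def fullBins (c : Fin b → Option Z × Option Z) : ℕ → Finset Z
  | 0 => ∅
  | n + 1 => if h : n < b then addBall (fullBins c n) (c ⟨n, h⟩) else fullBins c n

/-- The number of nonempty bins at time `b` when the adaptive algorithm with the fractional matching
`f` and the neighbour lists `nbrs` meets the arrivals `ω` and draws the numbers `x`. -/
def algSize (r : Y → ℝ) (f : Y → Z → ℝ) (nbrs : Y → List Z) (ω : Fin b → Y) (x : Fin b → ℝ) : ℕ :=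
  (fullBins (fun t => (firstBin (f (ω t)) (nbrs (ω t)) (x t),
    secondBin (r (ω t)) (f (ω t)) (nbrs (ω t)) (x t))) b).card

/-- The uniform distribution on `[0, ρ]`. -/
def uniformMeasure (ρ : ℝ) : Measure ℝ :=
  ProbabilityTheory.cond volume (Set.Icc 0 ρ)

/-- The expected number of nonempty bins at time `b`: the arrivals `ω` are random, and given `ω` the
numbers `x t` are independent, with `x t` uniform on `[0, r (ω t)]`. -/
def expectedAlg [Fintype Y] (b : ℕ) (r : Y → ℝ) (f : Y → Z → ℝ) (nbrs : Y → List Z) : ℝ :=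
  ∑ ω : Fin b → Y, seqProb r ω *
    ∫ x, (algSize r f nbrs ω x : ℝ) ∂(Measure.pi fun t => uniformMeasure (r (ω t)))

/-- The competitive ratio of the adaptive algorithm against the optimum offline allocation `opt`,
from which the algorithm computes its fractional matching. -/
def competitiveRatio [Fintype Y] (r : Y → ℝ) (opt : (Fin b → Y) → Fin b → Option Z)
    (nbrs : Y → List Z) : ℝ :=
  expectedAlg b r (fracMatching r opt) nbrs / expectedOpt r opt

end

end OnlineMatching

open OnlineMatching

/-! Record each ball by its pair (first choice, second choice). These pairs are independent with a
common law p (`choiceLaw`). Put a_z = ∑_y f_(y,z). Both marginals of b·p at z equal a_z, every a_z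
is at most 1, and the a_z add up to E[OPT], so it remains to bound the probability that a bin z
stays empty.

An empty z is filled by a ball with first choice z, by a pair (dummy, z), and by a pair (w, z) once
w is full. The bin w is full at the latest after some ball has had first choice w. This gives one
delayed clock for each w ≠ z, and the product of their survival probabilities is a valid bound even
though the clocks are dependent: `potential` is a supermartingale (`sum_mul_potential_le`). With g =
b·p(w, z), a clock survives with probability at most about exp(-g(1 - log(1 + a_w)/a_w))
(`delayedSurvival_le_exp`). In the worst case a_w = 1, a second choice therefore counts with weight
1 - log 2.

Pairs (z, z) are wasted. The second partition keeps their expected number below 1 - log 2 + 8/b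
(`sum_max_le`, `mul_choiceLaw_diag_le`). If all a_z = 1, the exponent is about 1 + (1 - log 2) log
2, and 1 - exp(-1.2127) exceeds 0.702.

When a_w < 1, second choices after w count less, but w itself is filled with probability more than
0.702 a_w. The loss (`shortfall`) is charged to w, whose surplus 0.61 (log(1 + a_w) - a_w log 2)
pays for it (`gain_of_le_half`, `gain_of_half_le`, `le_sum_mul_card_fullBins`). -/

namespace OnlineMatching

/-! ### A clock that starts at the first arrival -/

/-- The probability that `m` independent trials show no failure, when failures are possible only
after the first starting event: each trial is a starting event with probability `α`, and once one
has occurred each trial is a failure with probability `γ`. -/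
noncomputable def delayedSurvival (α γ : ℝ) : ℕ → ℝ
  | 0 => 1
  | m + 1 => (1 - α) * delayedSurvival α γ m + α * (1 - γ) ^ m

/-- One ball advances at most one of the clocks, so the true one-step factor has the form of the
left side. Independent clocks would give the right side. This inequality permits treating them as
independent. -/
theorem one_sub_sum_le_prod_one_sub {ι : Type*} (s : Finset ι) (x : ι → ℝ)
    (h0 : ∀ i ∈ s, 0 ≤ x i) (h1 : ∀ i ∈ s, x i ≤ 1) :
    1 - ∑ i ∈ s, x i ≤ ∏ i ∈ s, (1 - x i) := by
  classical
  induction s using Finset.induction_on with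
  | empty => simp
  | insert a s ha ih =>
    rw [Finset.sum_insert ha, Finset.prod_insert ha]
    have h0' : ∀ i ∈ s, 0 ≤ x i := fun i hi => h0 i (Finset.mem_insert_of_mem hi)
    have h1' : ∀ i ∈ s, x i ≤ 1 := fun i hi => h1 i (Finset.mem_insert_of_mem hi)
    have ih := ih h0' h1'
    have ha0 := h0 a (Finset.mem_insert_self _ _)
    have ha1 := h1 a (Finset.mem_insert_self _ _)
    have hs := Finset.sum_nonneg h0'
    nlinarith [mul_nonneg ha0 hs, mul_le_mul_of_nonneg_left ih (sub_nonneg.2 ha1)]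

section

variable {α γ : ℝ}

theorem pow_le_delayedSurvival (hα1 : α ≤ 1) (hγ0 : 0 ≤ γ) (hγ1 : γ ≤ 1) (m : ℕ) :
    (1 - γ) ^ m ≤ delayedSurvival α γ m := by
  induction m with
  | zero => simp [delayedSurvival]
  | succ m ih =>
    have hp : 0 ≤ (1 - γ) ^ m := pow_nonneg (by linarith) m
    rw [delayedSurvival, pow_succ]
    nlinarith [mul_le_mul_of_nonneg_left ih (sub_nonneg.2 hα1), mul_nonneg hp hγ0]

theorem delayedSurvival_nonneg (hα1 : α ≤ 1) (hγ0 : 0 ≤ γ) (hγ1 : γ ≤ 1) (m : ℕ) :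
    0 ≤ delayedSurvival α γ m :=
  (pow_nonneg (by linarith) m).trans (pow_le_delayedSurvival hα1 hγ0 hγ1 m)

/-- The quotient is the factor by which the bound drops when a clock starts. If its denominator
vanishes, so does its numerator, and the convention for division by zero does no harm. -/
theorem delayedSurvival_mul_div (hα1 : α ≤ 1) (hγ0 : 0 ≤ γ) (hγ1 : γ ≤ 1) (m : ℕ) :
    delayedSurvival α γ m * ((1 - γ) ^ m / delayedSurvival α γ m) = (1 - γ) ^ m := by
  refine mul_div_cancel_of_imp' fun h => ?_
  have := pow_le_delayedSurvival hα1 hγ0 hγ1 m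
  exact le_antisymm (this.trans h.le) (pow_nonneg (by linarith) m)

theorem pow_div_delayedSurvival_mem (hα1 : α ≤ 1) (hγ0 : 0 ≤ γ) (hγ1 : γ ≤ 1)
    (m : ℕ) : 0 ≤ (1 - γ) ^ m / delayedSurvival α γ m ∧
      (1 - γ) ^ m / delayedSurvival α γ m ≤ 1 :=
  ⟨div_nonneg (pow_nonneg (by linarith) m) (delayedSurvival_nonneg hα1 hγ0 hγ1 m),
    div_le_one_of_le₀ (pow_le_delayedSurvival hα1 hγ0 hγ1 m)
      (delayedSurvival_nonneg hα1 hγ0 hγ1 m)⟩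

/-- For θ = 1 survival means at most one starting event, and the base is the Poisson bound e^(-a)(1
+ a), a = αm, up to the correction e^α. Concavity of u ↦ u^θ carries the recursion over to smaller
θ. The correction appears because the starting trial contributes α without the decay factor e^(-α).
-/
theorem delayedSurvival_le_rpow {θ : ℝ} (hα0 : 0 ≤ α) (hα1 : α ≤ 1) (hγ1 : γ ≤ 1)
    (hθ0 : 0 ≤ θ) (hθ1 : θ ≤ 1) (hγ : γ = α * θ) (m : ℕ) :
    delayedSurvival α γ m ≤
      (Real.exp (-(α * m)) * (1 + m * (α * Real.exp α))) ^ θ := by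
  induction m with
  | zero => simp [delayedSurvival]
  | succ m ih =>
    set u := Real.exp (-(α * m)) * (1 + m * (α * Real.exp α)) with hu
    have hu0 : 0 ≤ u := by positivity
    have hpow : (1 - γ) ^ m ≤ Real.exp (-(α * m)) ^ θ := by
      have h1 : 1 - γ ≤ Real.exp (-γ) := by linarith [Real.add_one_le_exp (-γ)]
      calc (1 - γ) ^ m ≤ Real.exp (-γ) ^ m := pow_le_pow_left₀ (by linarith) h1 m
        _ = Real.exp (-(α * m)) ^ θ := by
          rw [← Real.exp_nat_mul, ← Real.exp_mul, hγ]; ring_nf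
    have hconc := (Real.concaveOn_rpow hθ0 hθ1).2 (x := u) hu0
      (y := Real.exp (-(α * m))) (Real.exp_pos _).le (sub_nonneg.2 hα1) hα0 (by ring)
    simp only [smul_eq_mul] at hconc
    rw [delayedSurvival]
    calc (1 - α) * delayedSurvival α γ m + α * (1 - γ) ^ m
        ≤ (1 - α) * u ^ θ + α * Real.exp (-(α * m)) ^ θ := by
          have := sub_nonneg.2 hα1
          gcongr
      _ ≤ ((1 - α) * u + α * Real.exp (-(α * m))) ^ θ := hconc
      _ ≤ _ := by
          have h1 : 1 - α ≤ Real.exp (-α) := by linarith [Real.add_one_le_exp (-α)]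
          have hsplit : Real.exp (-(α * (m + 1 : ℕ))) = Real.exp (-(α * m)) * Real.exp (-α) := by
            rw [← Real.exp_add]; push_cast; ring_nf
          have hinv : Real.exp (-α) * Real.exp α = 1 := by rw [← Real.exp_add]; simp
          have h2 : 0 ≤ (1 - α) * u + α * Real.exp (-(α * m)) := by
            have := sub_nonneg.2 hα1
            positivity
          refine Real.rpow_le_rpow h2 ?_ hθ0
          calc (1 - α) * u + α * Real.exp (-(α * m))
              ≤ Real.exp (-α) * u + α * Real.exp (-(α * m)) := by gcongr
            _ = Real.exp (-α) * u + α * Real.exp (-(α * m)) * (Real.exp (-α) * Real.exp α) := by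
              rw [hinv, mul_one]
            _ = _ := by rw [hsplit, hu]; push_cast; ring

theorem delayedSurvival_le_exp {a g : ℝ} {n : ℕ} (hn : 0 < n) (hg0 : 0 ≤ g) (hga : g ≤ a)
    (ha : a ≤ 1) :
    delayedSurvival (a / n) (g / n) n ≤ Real.exp (-(g * (1 - Real.log (1 + a) / a - 1 / n))) := by
  have hn' : (1 : ℝ) ≤ n := by exact_mod_cast hn
  have hn0 : (0 : ℝ) < n := by linarith
  rcases (hg0.trans hga).eq_or_lt with h | ha0
  · have hg : g = 0 := le_antisymm (h ▸ hga) hg0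
    subst hg
    subst h
    have : ∀ m, delayedSurvival (0 / n) (0 / n) m = 1 := by
      intro m
      induction m with
      | zero => rfl
      | succ m ih => simp [delayedSurvival] at ih ⊢; exact ih
    rw [this]; simp
  have hα1 : a / n ≤ 1 := by rw [div_le_one hn0]; linarith
  have hγ1 : g / n ≤ 1 := by rw [div_le_one hn0]; linarith
  -- Here θ is the conditional probability of a failure given a starting event. The factor e^(a/n)
  -- in the base becomes the error 1/n in the exponent.
  refine (delayedSurvival_le_rpow (θ := g / a) (by positivity) hα1 hγ1 (by positivity)
    (div_le_one_of_le₀ hga ha0.le) (by field_simp) n).trans ?_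
  have hexp : 1 ≤ Real.exp (a / n) := Real.one_le_exp (by positivity)
  have h1 : Real.exp (-(a / n * n)) * (1 + n * (a / n * Real.exp (a / n)))
      ≤ Real.exp (-a + Real.log (1 + a) + a / n) := by
    rw [Real.exp_add, Real.exp_add, Real.exp_log (by linarith), div_mul_cancel₀ _ hn0.ne']
    have : (n : ℝ) * (a / n * Real.exp (a / n)) = a * Real.exp (a / n) := by field_simp
    rw [this, mul_assoc]
    gcongr
    nlinarith
  calc _ ≤ Real.exp (-a + Real.log (1 + a) + a / n) ^ (g / a) :=
        Real.rpow_le_rpow (by positivity) h1 (by positivity)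
    _ = _ := by
      rw [← Real.exp_mul]
      congr 1
      field_simp
      ring

end

/-! ### The probability that a bin stays empty -/

section

open Finset

variable {Z : Type*}

theorem subset_addBall (S : Finset Z) (c : Option Z × Option Z) : S ⊆ addBall S c := by
  classical
  unfold addBall
  split_ifs <;> exact Finset.subset_union_left

theorem foldl_addBall_eq_fullBins {b : ℕ} (c : Fin b → Option Z × Option Z) :
    fullBins c b = (List.ofFn c).foldl addBall ∅ := by
  have key : ∀ n ≤ b, fullBins c n = ((List.ofFn c).take n).foldl addBall ∅ := by
    intro n
    induction n with
    | zero => intro _; simp [fullBins]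
    | succ n ih =>
      intro hn
      have hlt : n < b := hn
      rw [fullBins, dif_pos hlt, ih hlt.le, List.take_succ_eq_append_getElem (by simpa using hlt),
        List.foldl_append]
      simp
  have := key b le_rfl
  rwa [List.take_of_length_le (by simp)] at this

variable [Fintype Z]

open Classical in
/-- The probability that the first choice is the bin `z`, for choices with law `p`. -/
noncomputable def firstProb (p : Option Z × Option Z → ℝ) (z : Z) : ℝ :=
  ∑ c, p c * (if c.1 = some z then 1 else 0)

open Classical in
/-- An upper bound for the probability that `z` is empty after `m` more balls, when `S` is the set
of full bins. -/
noncomputable def potential (p : Option Z × Option Z → ℝ) (z : Z) (m : ℕ) (S : Finset Z) : ℝ :=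
  if z ∈ S then 0 else (1 - (firstProb p z + p (none, some z))) ^ m *
    ∏ w ∈ univ.erase z, if w ∈ S then (1 - p (some w, some z)) ^ m
      else delayedSurvival (firstProb p w) (p (some w, some z)) m

variable {p : Option Z × Option Z → ℝ}

theorem firstProb_nonneg (hp : ∀ c, 0 ≤ p c) (z : Z) : 0 ≤ firstProb p z := by
  classical
  exact sum_nonneg fun c _ => mul_nonneg (hp c) (by split_ifs <;> norm_num)

theorem firstProb_eq_sum (z : Z) : firstProb p z = ∑ o, p (some z, o) := by
  classical
  rw [firstProb, Fintype.sum_prod_type, sum_eq_single (some z)]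
  · simp
  · intro o _ ho; simp [ho]
  · simp

theorem le_firstProb (hp : ∀ c, 0 ≤ p c) (z : Z) (o : Option Z) :
    p (some z, o) ≤ firstProb p z := by
  rw [firstProb_eq_sum]
  exact single_le_sum (f := fun o => p (some z, o)) (fun o _ => hp _) (mem_univ o)

theorem firstProb_add_le_one (hp : ∀ c, 0 ≤ p c) (h1 : ∑ c, p c = 1) (z : Z) (o : Option Z) :
    firstProb p z + p (none, o) ≤ 1 := by
  classical
  rw [← h1, Fintype.sum_prod_type, Fintype.sum_option, add_comm]
  refine add_le_add (single_le_sum (f := fun o => p (none, o)) (fun o _ => hp _) (mem_univ o)) ?_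
  rw [firstProb_eq_sum]
  exact single_le_sum (f := fun z => ∑ o, p (some z, o))
    (fun z _ => sum_nonneg fun o _ => hp _) (mem_univ z)

theorem firstProb_le_one (hp : ∀ c, 0 ≤ p c) (h1 : ∑ c, p c = 1) (z : Z) : firstProb p z ≤ 1 := by
  linarith [firstProb_add_le_one hp h1 z none, hp (none, none)]

theorem choiceProb_le_one (hp : ∀ c, 0 ≤ p c) (h1 : ∑ c, p c = 1)
    (w : Z) (o : Option Z) : p (some w, o) ≤ 1 :=
  (le_firstProb hp w o).trans (firstProb_le_one hp h1 w)

theorem potential_nonneg (hp : ∀ c, 0 ≤ p c) (h1 : ∑ c, p c = 1)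
    (z : Z) (m : ℕ) (S : Finset Z) : 0 ≤ potential p z m S := by
  classical
  unfold potential
  split_ifs
  · rfl
  · refine mul_nonneg (pow_nonneg (by linarith [firstProb_add_le_one hp h1 z (some z)]) m)
      (prod_nonneg fun w _ => ?_)
    have hγ := choiceProb_le_one hp h1 w (some z)
    split_ifs
    · exact pow_nonneg (by linarith) m
    · exact delayedSurvival_nonneg (firstProb_le_one hp h1 w) (hp _) hγ m

/-- Bins filled by second choices are not followed by the clocks. By this monotonicity they can only
lower the bound, so they may be ignored. -/
theorem potential_anti (hp : ∀ c, 0 ≤ p c) (h1 : ∑ c, p c = 1)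
    (z : Z) (m : ℕ) {S T : Finset Z} (hST : S ⊆ T) :
    potential p z m T ≤ potential p z m S := by
  classical
  by_cases hT : z ∈ T
  · have : potential p z m T = 0 := by simp [potential, hT]
    rw [this]; exact potential_nonneg hp h1 z m S
  · have hS : z ∉ S := fun h => hT (hST h)
    simp only [potential, hT, hS, if_false]
    refine mul_le_mul_of_nonneg_left (prod_le_prod (fun w _ => ?_) fun w _ => ?_)
      (pow_nonneg (by linarith [firstProb_add_le_one hp h1 z (some z)]) m)
    · have hγ := choiceProb_le_one hp h1 w (some z)
      split_ifs
      · exact pow_nonneg (by linarith) m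
      · exact delayedSurvival_nonneg (firstProb_le_one hp h1 w) (hp _) hγ m
    · by_cases hwS : w ∈ S
      · simp [hwS, hST hwS]
      · by_cases hwT : w ∈ T
        · simp only [hwS, hwT, if_true, if_false]
          exact pow_le_delayedSurvival (firstProb_le_one hp h1 w) (hp _)
            (choiceProb_le_one hp h1 w (some z)) m
        · simp [hwS, hwT]

open Classical in
theorem potential_union_singleton (hp : ∀ c, 0 ≤ p c) (h1 : ∑ c, p c = 1)
    {z w : Z} (m : ℕ)
    {S : Finset Z} (hz : z ∉ S) (hw : w ∉ S) (hwz : w ≠ z) :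
    potential p z m (S ∪ {w}) = potential p z m S *
      ((1 - p (some w, some z)) ^ m / delayedSurvival (firstProb p w) (p (some w, some z)) m) := by
  have hz' : z ∉ S ∪ {w} := by simp [hz, hwz.symm]
  have hmem : w ∈ univ.erase z := by simp [hwz]
  have hR := delayedSurvival_mul_div (firstProb_le_one hp h1 w)
    (hp (some w, some z)) (choiceProb_le_one hp h1 w (some z)) m
  simp only [potential, hz, hz', if_false]
  rw [← mul_prod_erase _ _ hmem, ← mul_prod_erase _ _ hmem]
  have hcongr : ∀ v ∈ (univ.erase z).erase w,
      (if v ∈ S ∪ {w} then (1 - p (some v, some z)) ^ m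
        else delayedSurvival (firstProb p v) (p (some v, some z)) m) =
      if v ∈ S then (1 - p (some v, some z)) ^ m
        else delayedSurvival (firstProb p v) (p (some v, some z)) m := by
    intro v hv
    have : v ≠ w := (mem_erase.1 hv).1
    simp [this]
  rw [prod_congr rfl hcongr, if_pos (by simp), if_neg hw]
  generalize (1 - p (some w, some z)) ^ m /
    delayedSurvival (firstProb p w) (p (some w, some z)) m = R at hR ⊢
  rw [← hR]
  ring

open Classical in
/-- The relative decrease of `potential` at one step that the bin `w` accounts for. -/
noncomputable def potentialLoss (p : Option Z × Option Z → ℝ) (z : Z) (m : ℕ) (S : Finset Z)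
    (w : Z) : ℝ :=
  if w ∈ S then p (some w, some z)
  else firstProb p w * (1 - (1 - p (some w, some z)) ^ m /
    delayedSurvival (firstProb p w) (p (some w, some z)) m)

theorem potentialLoss_mem (hp : ∀ c, 0 ≤ p c) (h1 : ∑ c, p c = 1) (z : Z) (m : ℕ) (S : Finset Z)
    (w : Z) : 0 ≤ potentialLoss p z m S w ∧ potentialLoss p z m S w ≤ 1 := by
  have hγ := choiceProb_le_one hp h1 w (some z)
  have hα0 := firstProb_nonneg hp w
  have hα1 := firstProb_le_one hp h1 w
  obtain ⟨hR0, hR1⟩ := pow_div_delayedSurvival_mem hα1 (hp (some w, some z)) hγ m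
  unfold potentialLoss
  split_ifs
  · exact ⟨hp _, hγ⟩
  · exact ⟨mul_nonneg hα0 (by linarith), mul_le_one₀ hα1 (by linarith) (by linarith)⟩

-- The recursion of `delayedSurvival` says that a waiting clock with m + 1 trials left has the value
-- with m trials left times 1 minus its loss. A running clock just gains a factor 1 - γ. So one step
-- changes the potential by an exact product, which is compared with 1 minus the sum of the losses.
open Classical in
theorem mul_one_sub_le_potential_succ (hp : ∀ c, 0 ≤ p c) (h1 : ∑ c, p c = 1) {z : Z} (m : ℕ)
    {S : Finset Z} (hz : z ∉ S) :
    potential p z m S * (1 - (firstProb p z + p (none, some z)) -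
      ∑ w ∈ univ.erase z, potentialLoss p z m S w) ≤ potential p z (m + 1) S := by
  classical
  have hκ1 := firstProb_add_le_one hp h1 z (some z)
  have hκ0 := add_nonneg (firstProb_nonneg hp z) (hp (none, some z))
  have hx := fun w => potentialLoss_mem hp h1 z m S w
  have hsum : 0 ≤ ∑ w ∈ univ.erase z, potentialLoss p z m S w := sum_nonneg fun w _ => (hx w).1
  have hprod := one_sub_sum_le_prod_one_sub (univ.erase z) (potentialLoss p z m S)
    (fun w _ => (hx w).1) fun w _ => (hx w).2
  have heq : potential p z (m + 1) S = potential p z m S *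
      ((1 - (firstProb p z + p (none, some z))) *
        ∏ w ∈ univ.erase z, (1 - potentialLoss p z m S w)) := by
    simp only [potential, hz, if_false]
    rw [pow_succ, mul_mul_mul_comm, ← prod_mul_distrib]
    congr 1
    refine prod_congr rfl fun w _ => ?_
    unfold potentialLoss
    split_ifs
    · rw [pow_succ]
    · have hR := delayedSurvival_mul_div (firstProb_le_one hp h1 w)
        (hp (some w, some z)) (choiceProb_le_one hp h1 w (some z)) m
      rw [delayedSurvival]
      generalize (1 - p (some w, some z)) ^ m /
        delayedSurvival (firstProb p w) (p (some w, some z)) m = R at hR ⊢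
      rw [← hR]
      ring
  rw [heq]
  refine mul_le_mul_of_nonneg_left ?_ (potential_nonneg hp h1 z m S)
  nlinarith [mul_le_mul_of_nonneg_left hprod (sub_nonneg.2 hκ1), mul_nonneg hκ0 hsum]

-- Each pair has at most one recorded effect. It fills z, which makes the potential 0; or it starts
-- the clock of an empty w, which multiplies the potential by the quotient above; or its effect is
-- dropped by monotonicity.
open Classical in
theorem potential_addBall_le (hp : ∀ c, 0 ≤ p c) (h1 : ∑ c, p c = 1) {z : Z} (m : ℕ)
    {S : Finset Z} (hz : z ∉ S) (c : Option Z × Option Z) :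
    potential p z m (addBall S c) ≤ potential p z m S *
      (1 - ((if c.1 = some z then 1 else 0) + if c = (none, some z) then 1 else 0) -
        ∑ w ∈ univ.erase z, if w ∈ S then (if c = (some w, some z) then 1 else 0)
          else (if c.1 = some w then 1 else 0) * (1 - (1 - p (some w, some z)) ^ m /
            delayedSurvival (firstProb p w) (p (some w, some z)) m)) := by
  have hanti := potential_anti hp h1 z m (subset_addBall S c)
  have hzero : z ∈ addBall S c → potential p z m (addBall S c) = 0 := fun h => by
    simp [potential, h]
  obtain ⟨_ | w, o⟩ := c
  · by_cases ho : o = some z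
    · rw [hzero (by simp [addBall, ho])]
      simp [ho]
    · simpa [ho] using hanti
  · by_cases hwz : w = z
    · subst hwz
      rw [hzero (by simp [addBall, hz])]
      have : ∀ v ∈ univ.erase w, w ≠ v := fun v hv => (mem_erase.1 hv).1.symm
      rw [sum_eq_zero fun v hv => by simp [this v hv]]
      simp
    · have hmem : w ∈ univ.erase z := by simp [hwz]
      rw [sum_eq_single_of_mem w hmem fun v _ hv => by simp [hv.symm]]
      by_cases hwS : w ∈ S
      · by_cases ho : o = some z
        · rw [hzero (by simp [addBall, ho, hwS])]
          simp [ho, hwS, hwz]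
        · simpa [ho, hwS, hwz] using hanti
      · have : addBall S (some w, o) = S ∪ {w} := by simp [addBall, hwS]
        rw [this, potential_union_singleton hp h1 m hz hwS hwz]
        simp [hwz, hwS]

theorem sum_mul_potential_le (hp : ∀ c, 0 ≤ p c) (h1 : ∑ c, p c = 1) (z : Z) (m : ℕ)
    (S : Finset Z) : ∑ c, p c * potential p z m (addBall S c) ≤ potential p z (m + 1) S := by
  classical
  by_cases hz : z ∈ S
  · refine (sum_eq_zero fun c _ => ?_).trans_le (potential_nonneg hp h1 z _ S)
    simp [potential, subset_addBall S c hz]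
  refine (sum_le_sum fun c _ =>
    mul_le_mul_of_nonneg_left (potential_addBall_le hp h1 m hz c) (hp c)).trans ?_
  refine le_trans (le_of_eq ?_) (mul_one_sub_le_potential_succ hp h1 m hz)
  simp_rw [mul_left_comm (p _) (potential p z m S)]
  rw [← mul_sum]
  congr 1
  simp_rw [mul_sub, mul_add, mul_one, sum_sub_distrib, sum_add_distrib, h1, mul_sum]
  rw [sum_comm (s := univ) (t := univ.erase z)]
  congr 1
  · rw [firstProb]
    simp
  · refine sum_congr rfl fun w _ => ?_
    unfold potentialLoss
    split_ifs
    · simp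
    · simp only [mul_sub, mul_one, ← mul_assoc, sum_sub_distrib, ← sum_mul, firstProb]

open Classical in
/-- The probability that `z` is empty after `n` more balls, when `S` is the set of full bins. -/
theorem sum_prod_mul_not_mem_le (hp : ∀ c, 0 ≤ p c) (h1 : ∑ c, p c = 1) (z : Z) (n : ℕ)
    (S : Finset Z) :
    ∑ c : Fin n → Option Z × Option Z, (∏ t, p (c t)) *
      (if z ∈ (List.ofFn c).foldl addBall S then 0 else 1) ≤ potential p z n S := by
  induction n generalizing S with
  | zero => simp [potential, delayedSurvival]
  | succ n ih =>
    -- The earliest ball is split off, so that the induction hypothesis applies to the state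
    -- `addBall S c`.
    rw [← (Fin.consEquiv fun _ : Fin (n + 1) => Option Z × Option Z).sum_comp,
      Fintype.sum_prod_type]
    refine le_trans (sum_le_sum fun c _ => ?_) (sum_mul_potential_le hp h1 z n S)
    refine le_trans (le_of_eq ?_) (mul_le_mul_of_nonneg_left (ih (addBall S c)) (hp c))
    rw [mul_sum]
    refine sum_congr rfl fun d _ => ?_
    simp [Fin.consEquiv, Fin.prod_univ_succ, List.ofFn_succ]

end

end OnlineMatching

namespace OnlineMatching

/-! ### One-variable inequalities -/

theorem exp_neg_le_add_max {x y : ℝ} (hx : 0 ≤ x) :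
    Real.exp (-x) ≤ Real.exp (-y) + max (y - x) 0 := by
  rcases le_total y x with h | h
  · have := Real.exp_le_exp.2 (neg_le_neg h)
    linarith [le_max_right (y - x) 0]
  · have h1 : Real.exp (-y) = Real.exp (-x) * Real.exp (-(y - x)) := by
      rw [← Real.exp_add]; ring_nf
    have h2 := Real.add_one_le_exp (-(y - x))
    have h3 : Real.exp (-x) ≤ 1 := Real.exp_le_one_iff.2 (by linarith)
    rw [max_eq_left (by linarith), h1]
    nlinarith [Real.exp_pos (-x)]

theorem mul_log_two_le_log_one_add {a : ℝ} (h0 : 0 ≤ a) (h1 : a ≤ 1) :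
    a * Real.log 2 ≤ Real.log (1 + a) := by
  have h := strictConcaveOn_log_Ioi.concaveOn.2 (x := 1) (y := 2) (by simp) (by simp)
    (sub_nonneg.2 h1) h0 (by ring)
  simp only [smul_eq_mul, Real.log_one, mul_zero, zero_add] at h
  rwa [show (1 - a) * 1 + a * 2 = 1 + a by ring] at h

theorem log_three_halves_le : Real.log (1 + 1 / 2) ≤ 0.41 := by
  rw [Real.log_le_iff_le_exp (by norm_num)]
  have := Real.sum_le_exp_of_nonneg (x := 0.41) (by norm_num) 4
  norm_num [Finset.sum_range_succ, Nat.factorial] at this ⊢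
  linarith

theorem exp_neg_half_le : Real.exp (-(1 / 2)) ≤ 0.607 := by
  have := Real.sum_le_exp_of_nonneg (x := 1 / 2) (by norm_num) 5
  norm_num [Finset.sum_range_succ, Nat.factorial] at this
  rw [Real.exp_neg, inv_le_comm₀ (Real.exp_pos _) (by norm_num)]
  norm_num at this ⊢
  linarith

/-- The hypothesis says that the second derivative -m² e^(-(ma - n)) + K/(1 + a)² is nonpositive.
The gain inequalities then need checking only at the ends of an interval. -/
theorem concaveOn_gain {s t m n c K L : ℝ} (hs : 0 ≤ s)
    (h : ∀ a, s < a → a < t → K ≤ m ^ 2 * Real.exp (-(m * a - n)) * (1 + a) ^ 2) :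
    ConcaveOn ℝ (Set.Icc s t) fun a =>
      1 - Real.exp (-(m * a - n)) - c * a - K * (Real.log (1 + a) - a * L) := by
  refine concaveOn_of_hasDerivWithinAt2_nonpos (convex_Icc s t)
    (f' := fun a => m * Real.exp (-(m * a - n)) - c - K * ((1 + a)⁻¹ - L))
    (f'' := fun a => -(m ^ 2 * Real.exp (-(m * a - n))) + K * ((1 + a) ^ 2)⁻¹) ?_ ?_ ?_ ?_
  · refine ContinuousOn.sub (by fun_prop) (continuousOn_const.mul (ContinuousOn.sub ?_ (by fun_prop)))
    refine ContinuousOn.log (by fun_prop) fun x hx => ?_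
    linarith [hx.1]
  · intro x hx
    rw [interior_Icc] at hx
    have hx0 : 1 + x ≠ 0 := by linarith [hx.1]
    have e : HasDerivAt (fun a => Real.exp (-(m * a - n))) (Real.exp (-(m * x - n)) * -(m * 1)) x :=
      ((((hasDerivAt_id x).const_mul m).sub_const n).neg).exp
    have l : HasDerivAt (fun a => Real.log (1 + a)) (1 / (1 + x)) x :=
      ((hasDerivAt_id x).const_add 1).log hx0
    have := ((e.const_sub 1).sub ((hasDerivAt_id x).const_mul c)).sub
      ((l.sub ((hasDerivAt_id x).mul_const L)).const_mul K)
    refine HasDerivAt.hasDerivWithinAt (this.congr_deriv ?_)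
    simp only [one_div]
    ring
  · intro x hx
    rw [interior_Icc] at hx
    have hx0 : 1 + x ≠ 0 := by linarith [hx.1]
    have e : HasDerivAt (fun a => Real.exp (-(m * a - n))) (Real.exp (-(m * x - n)) * -(m * 1)) x :=
      ((((hasDerivAt_id x).const_mul m).sub_const n).neg).exp
    have l : HasDerivAt (fun a => (1 + a)⁻¹) (-1 / (1 + x) ^ 2) x :=
      ((hasDerivAt_id x).const_add 1).inv hx0
    have := ((e.const_mul m).sub_const c).sub ((l.sub_const L).const_mul K)
    refine HasDerivAt.hasDerivWithinAt (this.congr_deriv ?_)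
    field_simp
    ring
  · intro x hx
    rw [interior_Icc] at hx
    have hx0 : 0 < 1 + x := by linarith [hx.1]
    have := h x hx.1 hx.2
    rw [← div_eq_mul_inv]
    have : K / (1 + x) ^ 2 ≤ m ^ 2 * Real.exp (-(m * x - n)) := by
      rw [div_le_iff₀ (by positivity)]; exact this
    linarith

theorem nonneg_of_concaveOn {f : ℝ → ℝ} {s t a : ℝ} (hf : ConcaveOn ℝ (Set.Icc s t) f)
    (hs : 0 ≤ f s) (ht : 0 ≤ f t) (ha : a ∈ Set.Icc s t) : 0 ≤ f a := by
  have hst : s ≤ t := ha.1.trans ha.2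
  exact (le_min hs ht).trans (hf.min_le_of_mem_Icc ⟨le_rfl, hst⟩ ⟨hst, le_rfl⟩ ha)

/-- For small a the first choices alone suffice. Concavity follows from (1 - a)(1 + a)² ≥ 1 on this
range. -/
theorem gain_of_le_half {a : ℝ} (h0 : 0 ≤ a) (h1 : a ≤ 1 / 2) :
    0.702 * a + 0.61 * (Real.log (1 + a) - a * Real.log 2) ≤ 1 - Real.exp (-a) := by
  have hc := concaveOn_gain (s := 0) (t := 1 / 2) (m := 1) (n := 0) (c := 0.702) (K := 0.61)
    (L := Real.log 2) le_rfl fun a ha0 ha1 => by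
      have := Real.add_one_le_exp (-(1 * a - 0))
      have h2 : (1 - a) * (1 + a) ^ 2 ≤ Real.exp (-(1 * a - 0)) * (1 + a) ^ 2 :=
        mul_le_mul_of_nonneg_right (by linarith) (by positivity)
      have h3 : 0 ≤ a * (1 - a - a ^ 2) := mul_nonneg ha0.le (by nlinarith)
      norm_num at h2 ⊢
      linarith
  have := nonneg_of_concaveOn hc (by simp) (by
    have h1 := log_three_halves_le
    have h2 := exp_neg_half_le
    have h3 := Real.log_two_gt_d9
    norm_num at h1 h2 h3 ⊢
    linarith) ⟨h0, h1⟩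
  simp only [one_mul, sub_zero] at this
  linarith

/-- Here the second choices are needed: a mass of about a - (1 - log 2) of them is useful, with
weight 1 - log 2. The term 0.0003 leaves room for the errors of order 1/b. -/
theorem gain_of_half_le {a : ℝ} (h0 : 1 / 2 ≤ a) (h1 : a ≤ 1) :
    0.702 * a + 0.0003 + 0.61 * (Real.log (1 + a) - a * Real.log 2) ≤
      1 - Real.exp (-(a + (1 - Real.log 2) * (a - (1 - Real.log 2)))) := by
  have l1 := Real.log_two_gt_d9
  have l2 := Real.log_two_lt_d9
  obtain ⟨c, hc⟩ : ∃ c, c = 1 - Real.log 2 := ⟨_, rfl⟩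
  have hlog : Real.log 2 = 1 - c := by linarith
  have c1 : 0.30685 < c := by norm_num at l1 l2 ⊢; linarith
  have c2 : c < 0.30686 := by norm_num at l1 l2 ⊢; linarith
  -- With c = 1 - log 2, the exponent (1 + c)a - c² stays below 1.22 for a ≤ 1. This bound serves
  -- the concavity condition.
  have e1 : (0.29 : ℝ) ≤ Real.exp (-1.22) := by
    have h : Real.exp 1.22 ≤ 1 / 0.29 := by
      have h1 : Real.exp 1.22 = Real.exp 1 * Real.exp 0.22 := by rw [← Real.exp_add]; norm_num
      have h2 := Real.exp_one_lt_d9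
      have h4 : Real.exp 0.11 ≤ 1 / (1 - 0.11) :=
        Real.exp_bound_div_one_sub_of_interval (x := 0.11) (by norm_num) (by norm_num)
      have h5 : Real.exp 0.22 = Real.exp 0.11 * Real.exp 0.11 := by rw [← Real.exp_add]; norm_num
      have h6 : Real.exp 0.22 ≤ (1 / (1 - 0.11)) * (1 / (1 - 0.11)) := by
        rw [h5]; gcongr
      rw [h1]
      calc Real.exp 1 * Real.exp 0.22 ≤ 2.7182818286 * ((1 / (1 - 0.11)) * (1 / (1 - 0.11))) := by
            gcongr
        _ ≤ _ := by norm_num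
    rw [Real.exp_neg, le_inv_comm₀ (by norm_num) (Real.exp_pos _)]
    simpa using h
  have hcv := concaveOn_gain (s := 1 / 2) (t := 1) (m := 1 + c) (n := c ^ 2) (c := 0.702)
    (K := 0.61) (L := Real.log 2) (by norm_num) fun a ha0 ha1 => by
      have h2 : Real.exp (-1.22) ≤ Real.exp (-((1 + c) * a - c ^ 2)) := by
        refine Real.exp_le_exp.2 ?_
        nlinarith
      have h3 : (1.7 : ℝ) ≤ (1 + c) ^ 2 := by nlinarith
      have h4 : (2.25 : ℝ) ≤ (1 + a) ^ 2 := by nlinarith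
      calc (0.61 : ℝ) ≤ 1.7 * 0.29 * 2.25 := by norm_num
        _ ≤ _ := by
          have := e1.trans h2
          gcongr
  have hcv' := hcv.sub (convexOn_const (0.0003 : ℝ) (convex_Icc (1 / 2 : ℝ) 1))
  have := nonneg_of_concaveOn hcv' (by
    have h1 := log_three_halves_le
    have h2 : Real.exp (-((1 + c) * (1 / 2) - c ^ 2)) ≤ 0.607 := by
      refine le_trans (Real.exp_le_exp.2 ?_) exp_neg_half_le
      nlinarith
    simp only [Pi.sub_apply]
    norm_num at h1 h2 l1 l2 ⊢
    linarith) (by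
    -- The tight case of the theorem: at a = 1 the logarithmic terms cancel, and 1 - 0.2976 = 0.7024
    -- must exceed 0.702 + 0.0003.
    have h2 : Real.exp (-((1 + c) * 1 - c ^ 2)) ≤ 0.2976 := by
      have h1 : (1.2126 : ℝ) ≤ (1 + c) * 1 - c ^ 2 := by nlinarith
      have h3 := Real.exp_one_gt_d9
      have h4 := Real.sum_le_exp_of_nonneg (x := 0.2126) (by norm_num) 5
      have h5 : Real.exp 1.2126 = Real.exp 1 * Real.exp 0.2126 := by
        rw [← Real.exp_add]; norm_num
      refine (Real.exp_le_exp.2 (neg_le_neg h1)).trans ?_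
      rw [Real.exp_neg, inv_le_comm₀ (Real.exp_pos _) (by norm_num), h5]
      calc (0.2976 : ℝ)⁻¹ ≤ 2.7182818283 *
            ∑ i ∈ Finset.range 5, (0.2126 : ℝ) ^ i / (i.factorial : ℝ) := by
            norm_num [Finset.sum_range_succ, Nat.factorial]
        _ ≤ _ := mul_le_mul h3.le h4 (Finset.sum_nonneg fun i _ => by positivity)
            (Real.exp_pos 1).le
    have h6 : Real.log (1 + 1) = Real.log 2 := by norm_num
    simp only [Pi.sub_apply]
    rw [h6]
    linarith) ⟨h0, h1⟩
  simp only [Pi.sub_apply, hlog] at this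
  rw [hlog]
  have hexp : a + (1 - (1 - c)) * (a - (1 - (1 - c))) = (1 + c) * a - c ^ 2 := by ring
  rw [hexp]
  linarith

end OnlineMatching

namespace OnlineMatching

open Finset

/-! ### Expected number of full bins for independent choices -/

theorem sum_prod_mul_prod {Y : Type*} [Fintype Y] {n : ℕ} (p : Y → ℝ) (G : Fin n → Y → ℝ) :
    ∑ ω : Fin n → Y, (∏ t, p (ω t)) * ∏ t, G t (ω t) = ∏ t, ∑ y, p y * G t y := by
  classical
  rw [prod_univ_sum, Fintype.piFinset_univ]
  exact sum_congr rfl fun ω _ => prod_mul_distrib.symm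

theorem sum_prod_eq_one {Y : Type*} [Fintype Y] {n : ℕ} {p : Y → ℝ} (h1 : ∑ y, p y = 1) :
    ∑ ω : Fin n → Y, ∏ t, p (ω t) = 1 := by
  simpa [h1] using sum_prod_mul_prod (n := n) p fun _ _ => 1

section

variable {Z : Type*} [Fintype Z] {p : Option Z × Option Z → ℝ}

theorem one_sub_pow_le_exp {x : ℝ} (hx : x ≤ 1) (n : ℕ) : (1 - x) ^ n ≤ Real.exp (-(n * x)) := by
  rw [show -((n : ℝ) * x) = n * -x by ring, Real.exp_nat_mul]
  exact pow_le_pow_left₀ (by linarith) (by linarith [Real.add_one_le_exp (-x)]) n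

theorem potential_empty_le_exp_firstProb (hp : ∀ c, 0 ≤ p c) (h1 : ∑ c, p c = 1) (z : Z) (n : ℕ) :
    potential p z n ∅ ≤ Real.exp (-(n * firstProb p z)) := by
  classical
  have hκ := firstProb_add_le_one hp h1 z (some z)
  simp only [potential, notMem_empty, if_false]
  have hprod : ∏ w ∈ univ.erase z, delayedSurvival (firstProb p w) (p (some w, some z)) n ≤ 1 := by
    refine prod_le_one (fun w _ => delayedSurvival_nonneg (firstProb_le_one hp h1 w) (hp _)
      (choiceProb_le_one hp h1 w (some z)) n) fun w _ => ?_
    have hα0 := firstProb_nonneg hp w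
    have hα1 := firstProb_le_one hp h1 w
    have hγ0 := hp (some w, some z)
    have hγ1 := choiceProb_le_one hp h1 w (some z)
    generalize firstProb p w = α at *
    generalize p (some w, some z) = γ at *
    induction n with
    | zero => rfl
    | succ n ih =>
      have : (1 - γ) ^ n ≤ 1 := pow_le_one₀ (by linarith) (by linarith)
      rw [delayedSurvival]
      nlinarith
  refine (mul_le_of_le_one_right (pow_nonneg (by linarith) n) hprod).trans ?_
  refine (one_sub_pow_le_exp hκ n).trans (Real.exp_le_exp.2 ?_)
  have : (0 : ℝ) ≤ n * p (none, some z) := mul_nonneg n.cast_nonneg (hp _)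
  linarith

open Classical in
theorem potential_empty_le_exp (hp : ∀ c, 0 ≤ p c) (h1 : ∑ c, p c = 1) (z : Z) {n : ℕ}
    (hn : 0 < n) {a : Z → ℝ} (ha : ∀ w, n * firstProb p w = a w) (ha1 : ∀ w, a w ≤ 1) :
    potential p z n ∅ ≤ Real.exp (-(a z + n * p (none, some z) + ∑ w ∈ univ.erase z,
      n * p (some w, some z) * (1 - Real.log (1 + a w) / a w - 1 / n))) := by
  have hκ := firstProb_add_le_one hp h1 z (some z)
  have hn0 : (0 : ℝ) < n := by exact_mod_cast hn
  simp only [potential, notMem_empty, if_false]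
  rw [neg_add, Real.exp_add, ← sum_neg_distrib, Real.exp_sum]
  refine mul_le_mul ?_ (prod_le_prod (fun w _ => ?_) fun w _ => ?_)
    (prod_nonneg fun w _ => ?_) (Real.exp_pos _).le
  · refine (one_sub_pow_le_exp hκ n).trans (le_of_eq ?_)
    rw [mul_add, ha]
  · exact delayedSurvival_nonneg (firstProb_le_one hp h1 w) (hp _)
      (choiceProb_le_one hp h1 w (some z)) n
  · have h := delayedSurvival_le_exp (a := a w) (g := n * p (some w, some z)) hn
      (mul_nonneg hn0.le (hp _))
      (by rw [← ha]; exact mul_le_mul_of_nonneg_left (le_firstProb hp w _) hn0.le) (ha1 w)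
    rwa [← ha, mul_div_cancel_left₀ _ hn0.ne', mul_div_cancel_left₀ _ hn0.ne', ha] at h
  · exact delayedSurvival_nonneg (firstProb_le_one hp h1 w) (hp _)
      (choiceProb_le_one hp h1 w (some z)) n

/-- The amount by which the second choices of `z` after the first choice `w` fall short of
the worst case `a w = 1`. -/
noncomputable def shortfall (p : Option Z × Option Z → ℝ) (n : ℕ) (a : Z → ℝ) (w z : Z) : ℝ :=
  n * p (some w, some z) * (Real.log (1 + a w) / a w - Real.log 2)

theorem shortfall_nonneg (hp : ∀ c, 0 ≤ p c) {n : ℕ} {a : Z → ℝ}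
    (ha : ∀ w, n * firstProb p w = a w) (ha1 : ∀ w, a w ≤ 1) (w z : Z) :
    0 ≤ shortfall p n a w z := by
  have hg : 0 ≤ n * p (some w, some z) := mul_nonneg n.cast_nonneg (hp _)
  have hga : n * p (some w, some z) ≤ a w := by
    rw [← ha]; exact mul_le_mul_of_nonneg_left (le_firstProb hp w _) n.cast_nonneg
  -- For a w = 0 the quotient log(1 + a w)/a w is 0 by convention and the bracket is negative, but
  -- then p(w, z) vanishes too.
  rcases (hg.trans hga).eq_or_lt with h | h
  · have : n * p (some w, some z) = 0 := le_antisymm (hga.trans h.ge) hg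
    simp [shortfall, this]
  · refine mul_nonneg hg (sub_nonneg.2 ?_)
    rw [le_div_iff₀ h, mul_comm]
    exact mul_log_two_le_log_one_add h.le (ha1 w)

/-- The masses of the pairs (w, z) over all z add up to at most a w, so the total charge to w
depends on a w alone. -/
theorem sum_shortfall_le (hp : ∀ c, 0 ≤ p c) {n : ℕ} {a : Z → ℝ}
    (ha : ∀ w, n * firstProb p w = a w) (ha1 : ∀ w, a w ≤ 1) (w : Z) :
    ∑ z, shortfall p n a w z ≤ Real.log (1 + a w) - a w * Real.log 2 := by
  have ha0 : 0 ≤ a w := by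
    rw [← ha]; exact mul_nonneg n.cast_nonneg (firstProb_nonneg hp w)
  unfold shortfall
  rw [← sum_mul, ← mul_sum]
  have hle : n * ∑ z, p (some w, some z) ≤ a w := by
    rw [← ha, firstProb_eq_sum, Fintype.sum_option]
    exact mul_le_mul_of_nonneg_left (by linarith [hp (some w, none)]) n.cast_nonneg
  rcases ha0.eq_or_lt with h | h
  · have h0 : 0 ≤ n * ∑ z, p (some w, some z) :=
      mul_nonneg n.cast_nonneg (sum_nonneg fun z _ => hp _)
    have : n * ∑ z, p (some w, some z) = 0 := le_antisymm (hle.trans h.ge) h0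
    simp [this, ← h]
  · have h2 : 0 ≤ Real.log (1 + a w) / a w - Real.log 2 := by
      rw [sub_nonneg, le_div_iff₀ h, mul_comm]
      exact mul_log_two_le_log_one_add h.le (ha1 w)
    refine (mul_le_mul_of_nonneg_right hle h2).trans (le_of_eq ?_)
    field_simp

/-- Lowering the exponent from y to x costs at most e^(-A) times the difference, and e^(-1/2) <
0.61. This is the source of the rate 0.61 and of the threshold 1/2. The terms in ε cost about 6 ·
10⁻⁵, well below 0.0003. -/
theorem exp_neg_le_of_half_le {A x y D S ε : ℝ} (hA : 1 / 2 ≤ A) (hx : 0 ≤ x) (hD : 0 ≤ D)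
    (hyx : y - x ≤ D + 8 * ε) (hS : S ≤ 1) (hε0 : 0 < ε) (hε : ε ≤ 1 / 10 ^ 5) :
    Real.exp (-(A + x - S * ε)) ≤ Real.exp (-(A + y)) + 0.0003 + 0.61 * D := by
  have hlip := exp_neg_le_add_max (y := y) hx
  have hmax : max (y - x) 0 ≤ D + 8 * ε := max_le hyx (by positivity)
  have he1 : Real.exp (-A) ≤ 0.607 :=
    (Real.exp_le_exp.2 (neg_le_neg hA)).trans exp_neg_half_le
  have he2 : Real.exp ε ≤ 1 + 2 * ε := by
    have := Real.exp_bound_div_one_sub_of_interval hε0.le (by linarith)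
    refine this.trans ?_
    rw [div_le_iff₀ (by linarith)]
    nlinarith
  have hex : Real.exp (-x) ≤ 1 := Real.exp_le_one_iff.2 (by linarith)
  have hea := Real.exp_pos (-A)
  calc Real.exp (-(A + x - S * ε)) ≤ Real.exp (-A + (-x + ε)) := by
        refine Real.exp_le_exp.2 ?_
        nlinarith
    _ = Real.exp (-A) * (Real.exp (-x) * Real.exp ε) := by
        rw [Real.exp_add, Real.exp_add]
    _ ≤ Real.exp (-A) * (Real.exp (-y) + D + 10 * ε) := by
        refine mul_le_mul_of_nonneg_left ?_ hea.le
        nlinarith [mul_le_mul_of_nonneg_left he2 (Real.exp_pos (-x)).le]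
    _ = Real.exp (-(A + y)) + Real.exp (-A) * (D + 10 * ε) := by
        rw [neg_add, Real.exp_add]; ring
    _ ≤ _ := by
        have : Real.exp (-A) * (D + 10 * ε) ≤ 0.607 * (D + 10 * ε) := by gcongr
        norm_num at this hε ⊢
        linarith

/-- Of the mass a z of second choices, at most 1 - log 2 + 8/n lies on the diagonal and is lost. The
rest has weight at least 1 - log 2 (weight 1 after a dummy first choice), up to the shortfall and
the 1/n error of the clocks. -/
theorem potential_empty_le_of_half_le (hp : ∀ c, 0 ≤ p c) (h1 : ∑ c, p c = 1) (z : Z) {n : ℕ}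
    (hn : 10 ^ 5 ≤ n) {a : Z → ℝ} (ha : ∀ w, n * firstProb p w = a w) (ha1 : ∀ w, a w ≤ 1)
    (hsec : n * ∑ o, p (o, some z) = a z)
    (hdiag : n * p (some z, some z) ≤ 1 - Real.log 2 + 8 / n) (hz : 1 / 2 ≤ a z) :
    potential p z n ∅ ≤
      Real.exp (-(a z + (1 - Real.log 2) * (a z - (1 - Real.log 2)))) + 0.0003 +
        0.61 * ∑ w, shortfall p n a w z := by
  classical
  have hn0 : (0 : ℝ) < n := by
    have : 0 < n := by omega
    exact_mod_cast this
  have hn5 : (10 ^ 5 : ℝ) ≤ n := by exact_mod_cast hn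
  have hinv : 1 / (n : ℝ) ≤ 1 / 10 ^ 5 := one_div_le_one_div_of_le (by norm_num) hn5
  have hinv0 : 0 < 1 / (n : ℝ) := by positivity
  have hlog1 := Real.log_two_gt_d9
  have hlog2 := Real.log_two_lt_d9
  refine (potential_empty_le_exp hp h1 z (by omega) ha ha1).trans ?_
  set g : Z → ℝ := fun w => n * p (some w, some z) with hg
  have hg0 : ∀ w, 0 ≤ g w := fun w => mul_nonneg hn0.le (hp _)
  set g0 := n * p (none, some z) with hg0_def
  have hg00 : 0 ≤ g0 := mul_nonneg hn0.le (hp _)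
  have hsplit : g0 + (g z + ∑ w ∈ univ.erase z, g w) = a z := by
    rw [← hsec, Fintype.sum_option, mul_add, mul_sum, ← add_sum_erase _ _ (mem_univ z)]
  have hq : ∀ w, 0 ≤ g w * (1 - Real.log (1 + a w) / a w) := fun w => by
    refine mul_nonneg (hg0 w) (sub_nonneg.2 ?_)
    have ha0 : 0 ≤ a w := by
      rw [← ha]; exact mul_nonneg hn0.le (firstProb_nonneg hp w)
    refine div_le_one_of_le₀ ?_ ha0
    linarith [Real.log_le_sub_one_of_pos (show 0 < 1 + a w by linarith)]
  set D := ∑ w, shortfall p n a w z with hD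
  have hD0 : 0 ≤ D := sum_nonneg fun w _ => shortfall_nonneg hp ha ha1 w z
  have hDle : ∑ w ∈ univ.erase z, shortfall p n a w z ≤ D :=
    sum_le_sum_of_subset_of_nonneg (erase_subset _ _) fun w _ _ => shortfall_nonneg hp ha ha1 w z
  set x := g0 + ∑ w ∈ univ.erase z, g w * (1 - Real.log (1 + a w) / a w) with hx
  have hx0 : 0 ≤ x := add_nonneg hg00 (sum_nonneg fun w _ => hq w)
  have hx1 : x = g0 + (1 - Real.log 2) * ∑ w ∈ univ.erase z, g w -
      ∑ w ∈ univ.erase z, shortfall p n a w z := by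
    rw [hx, mul_sum, add_sub_assoc, ← sum_sub_distrib]
    congr 1
    refine sum_congr rfl fun w _ => ?_
    rw [shortfall]
    ring
  have hrew : a z + g0 + ∑ w ∈ univ.erase z, g w * (1 - Real.log (1 + a w) / a w - 1 / n) =
      a z + x - (∑ w ∈ univ.erase z, g w) * (1 / n) := by
    rw [hx, sum_mul]
    simp_rw [mul_sub (g _) (1 - _) (1 / (n : ℝ)), sum_sub_distrib]
    ring
  rw [hrew]
  have hS1 : ∑ w ∈ univ.erase z, g w ≤ 1 := by linarith [ha1 z, hg0 z]
  have hS : a z - (1 - Real.log 2 + 8 / n) ≤ g0 + ∑ w ∈ univ.erase z, g w := by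
    have : g z ≤ 1 - Real.log 2 + 8 / n := hdiag
    linarith
  have h8 : 8 / (n : ℝ) = 8 * (1 / n) := by ring
  set y := (1 - Real.log 2) * (a z - (1 - Real.log 2)) with hy
  have hy0 : 0 ≤ y := mul_nonneg (by norm_num at hlog2 ⊢; linarith) (by norm_num at hlog1 ⊢; linarith)
  have hyx : y - x ≤ D + 8 * (1 / n) := by
    have h2 : 0 ≤ 1 - Real.log 2 := by norm_num at hlog2 ⊢; linarith
    have h3 := mul_le_mul_of_nonneg_left hS h2
    nlinarith
  exact exp_neg_le_of_half_le hz hx0 hD0 hyx hS1 hinv0 hinv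

theorem le_sum_mul_card_fullBins (hp : ∀ c, 0 ≤ p c) (h1 : ∑ c, p c = 1) {n : ℕ}
    (hn : 10 ^ 5 ≤ n) {a : Z → ℝ} (ha : ∀ w, n * firstProb p w = a w) (ha1 : ∀ w, a w ≤ 1)
    (hsec : ∀ z, n * ∑ o, p (o, some z) = a z)
    (hdiag : ∀ z, n * p (some z, some z) ≤ 1 - Real.log 2 + 8 / n) :
    0.702 * ∑ z, a z ≤
      ∑ c : Fin n → Option Z × Option Z, (∏ t, p (c t)) * (fullBins c n).card := by
  classical
  have hcard : ∑ c : Fin n → Option Z × Option Z, (∏ t, p (c t)) * ((fullBins c n).card : ℝ) =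
      ∑ z, (1 - ∑ c : Fin n → Option Z × Option Z, (∏ t, p (c t)) *
        (if z ∈ (List.ofFn c).foldl addBall ∅ then (0 : ℝ) else 1)) := by
    have hone : ∀ z, 1 - ∑ c : Fin n → Option Z × Option Z, (∏ t, p (c t)) *
        (if z ∈ (List.ofFn c).foldl addBall ∅ then (0 : ℝ) else 1) =
        ∑ c : Fin n → Option Z × Option Z, (∏ t, p (c t)) *
          (if z ∈ (List.ofFn c).foldl addBall ∅ then (1 : ℝ) else 0) := fun z => by
      rw [sub_eq_iff_eq_add, ← sum_add_distrib]
      refine (sum_prod_eq_one (n := n) h1).symm.trans ?_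
      refine sum_congr rfl fun c _ => ?_
      split_ifs <;> simp
    simp_rw [hone]
    rw [sum_comm]
    refine sum_congr rfl fun c _ => ?_
    rw [foldl_addBall_eq_fullBins, ← mul_sum]
    simp
  rw [hcard]
  have ha0 : ∀ w, 0 ≤ a w := fun w => by
    rw [← ha]; exact mul_nonneg n.cast_nonneg (firstProb_nonneg hp w)
  have hz : ∀ z, 0.702 * a z + 0.61 * (Real.log (1 + a z) - a z * Real.log 2) -
      0.61 * ∑ w, shortfall p n a w z ≤ 1 - ∑ c : Fin n → Option Z × Option Z, (∏ t, p (c t)) *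
        (if z ∈ (List.ofFn c).foldl addBall ∅ then (0 : ℝ) else 1) := fun z => by
    refine le_trans ?_ (sub_le_sub_left (sum_prod_mul_not_mem_le hp h1 z n ∅) 1)
    rcases le_total (a z) (1 / 2) with h | h
    · have h2 := potential_empty_le_exp_firstProb hp h1 z n
      rw [ha] at h2
      have h3 := gain_of_le_half (ha0 z) h
      have h4 : 0 ≤ ∑ w, shortfall p n a w z :=
        sum_nonneg fun w _ => shortfall_nonneg hp ha ha1 w z
      linarith
    · have h2 := potential_empty_le_of_half_le hp h1 z hn ha ha1 (hsec z) (hdiag z) h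
      have h3 := gain_of_half_le h (ha1 z)
      linarith
  refine le_trans ?_ (sum_le_sum fun z _ => hz z)
  -- Exchanging the sums collects the charges by the bin w that causes them, where its surplus
  -- covers them.
  rw [sum_sub_distrib, sum_add_distrib, ← mul_sum, ← mul_sum, ← mul_sum, sum_comm]
  have := sum_le_sum fun w (_ : w ∈ univ) => sum_shortfall_le hp ha ha1 w
  linarith

end

end OnlineMatching

namespace OnlineMatching

open MeasureTheory

/-! ### The two partitions -/

section

variable {Z : Type*} {φ : Z → ℝ}

theorem sumBefore_cons_self (a : Z) (l : List Z) : sumBefore φ (a :: l) a = 0 := by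
  simp [sumBefore]

theorem sumBefore_cons_of_ne {a z : Z} (h : z ≠ a) (l : List Z) :
    sumBefore φ (a :: l) z = φ a + sumBefore φ l z := by
  simp [sumBefore, h.symm]

theorem sumBefore_nonneg (hφ : ∀ z, 0 ≤ φ z) (l : List Z) (z : Z) : 0 ≤ sumBefore φ l z :=
  List.sum_nonneg fun x hx => by
    obtain ⟨w, -, rfl⟩ := List.mem_map.1 hx
    exact hφ w

theorem sumBefore_add_le (hφ : ∀ z, 0 ≤ φ z) {l : List Z} {z : Z} (hz : z ∈ l) :
    sumBefore φ l z + φ z ≤ (l.map φ).sum := by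
  induction l with
  | nil => simp at hz
  | cons a l ih =>
    rw [List.map_cons, List.sum_cons]
    by_cases h : z = a
    · subst h
      rw [sumBefore_cons_self]
      have : 0 ≤ (l.map φ).sum := List.sum_nonneg fun x hx => by
        obtain ⟨w, -, rfl⟩ := List.mem_map.1 hx
        exact hφ w
      linarith
    · rw [sumBefore_cons_of_ne h]
      linarith [ih ((List.mem_cons.1 hz).resolve_left h)]

theorem sumBefore_add_le_or (hφ : ∀ z, 0 ≤ φ z) {l : List Z} {z w : Z} (hz : z ∈ l) (hw : w ∈ l)
    (hzw : z ≠ w) :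
    sumBefore φ l z + φ z ≤ sumBefore φ l w ∨ sumBefore φ l w + φ w ≤ sumBefore φ l z := by
  induction l with
  | nil => simp at hz
  | cons a l ih =>
    by_cases h : z = a
    · subst h
      rw [sumBefore_cons_self, sumBefore_cons_of_ne hzw.symm]
      left
      linarith [sumBefore_nonneg hφ l w]
    · by_cases h' : w = a
      · subst h'
        rw [sumBefore_cons_self, sumBefore_cons_of_ne hzw]
        right
        linarith [sumBefore_nonneg hφ l z]
      · rw [sumBefore_cons_of_ne h, sumBefore_cons_of_ne h']
        rcases ih ((List.mem_cons.1 hz).resolve_left h) ((List.mem_cons.1 hw).resolve_left h')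
          with h | h
        · left; linarith
        · right; linarith

theorem find?_eq_some_iff_of_unique {P : Z → Prop} [DecidablePred P] {l : List Z}
    (hP : ∀ z ∈ l, ∀ w ∈ l, P z → P w → z = w) (z : Z) :
    (l.find? fun z => decide (P z)) = some z ↔ z ∈ l ∧ P z := by
  refine ⟨fun h => ⟨List.mem_of_find?_eq_some h, by simpa using List.find?_some h⟩, fun h => ?_⟩
  have hs : (l.find? fun z => decide (P z)).isSome := by
    rw [List.find?_isSome]; exact ⟨z, h.1, by simpa using h.2⟩
  obtain ⟨w, hw⟩ := Option.isSome_iff_exists.1 hs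
  rw [hw, hP w (List.mem_of_find?_eq_some hw) z h.1 (by simpa using List.find?_some hw) h.2]

/-- The intervals are pairwise disjoint, so the order of the search through the list is irrelevant.
-/
theorem firstBin_eq_some_iff (hφ : ∀ z, 0 ≤ φ z) {l : List Z} {z : Z} {x : ℝ} :
    firstBin φ l x = some z ↔ z ∈ l ∧ x ∈ intervalI φ l z := by
  classical
  refine find?_eq_some_iff_of_unique (fun z hz w hw h1 h2 => ?_) z
  by_contra hzw
  rcases sumBefore_add_le_or hφ hz hw hzw with h | h
  · linarith [h1.2, h2.1]
  · linarith [h2.2, h1.1]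

theorem secondBin_eq_some_iff (hφ : ∀ z, 0 ≤ φ z) {l : List Z} {ρ : ℝ}
    (hl : (l.map φ).sum ≤ ρ) {z : Z} {x : ℝ} :
    secondBin ρ φ l x = some z ↔ z ∈ l ∧ x ∈ intervalJ ρ φ l z := by
  classical
  refine find?_eq_some_iff_of_unique (fun z hz w hw h1 h2 => ?_) z
  by_contra hzw
  obtain _ | ⟨a, l⟩ := l
  · simp at hz
  rw [List.map_cons, List.sum_cons] at hl
  simp only [intervalJ, List.head?_cons, Option.some.injEq, List.tail_cons] at h1 h2
  by_cases h : a = z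
  · have h' : a ≠ w := fun h' => hzw (h.symm.trans h')
    rw [if_pos h] at h1
    rw [if_neg h'] at h2
    have := sumBefore_add_le hφ ((List.mem_cons.1 hw).resolve_left h'.symm)
    subst h
    linarith [h1.1, h2.2]
  · rw [if_neg h] at h1
    have hz' := (List.mem_cons.1 hz).resolve_left (Ne.symm h)
    by_cases h' : a = w
    · rw [if_pos h'] at h2
      have := sumBefore_add_le hφ hz'
      subst h'
      linarith [h2.1, h1.2]
    · rw [if_neg h'] at h2
      have hw' := (List.mem_cons.1 hw).resolve_left (Ne.symm h')
      rcases sumBefore_add_le_or hφ hz' hw' hzw with h | h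
      · linarith [h1.2, h2.1]
      · linarith [h2.2, h1.1]

/-- For ρ = 0 the conditioning event is null and the measure is 0. Types with rate 0 carry weight 0
in every later sum. -/
instance (ρ : ℝ) : IsZeroOrProbabilityMeasure (uniformMeasure ρ) := by
  unfold uniformMeasure; infer_instance

theorem uniformMeasure_real_Ico {ρ s t : ℝ} (hρ : 0 < ρ) (hs : 0 ≤ s) (ht : t ≤ ρ) :
    (uniformMeasure ρ).real (Set.Ico s t) = max (t - s) 0 / ρ := by
  have hsub : Set.Icc 0 ρ ∩ Set.Ico s t = Set.Ico s t :=
    Set.inter_eq_right.2 fun x hx => ⟨hs.trans hx.1, hx.2.le.trans ht⟩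
  rw [uniformMeasure, measureReal_def, ProbabilityTheory.cond_apply measurableSet_Icc, hsub,
    Real.volume_Icc, Real.volume_Ico, sub_zero, ENNReal.toReal_mul, ENNReal.toReal_inv,
    ENNReal.toReal_ofReal hρ.le, ENNReal.toReal_ofReal', inv_mul_eq_div]

theorem measureReal_firstBin (hφ : ∀ z, 0 ≤ φ z) {l : List Z} {ρ : ℝ} (hρ : 0 < ρ)
    (hl : (l.map φ).sum ≤ ρ) {z : Z} (hz : z ∈ l) :
    (uniformMeasure ρ).real {x | firstBin φ l x = some z} = φ z / ρ := by
  have : {x | firstBin φ l x = some z} = intervalI φ l z := by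
    ext x; simp [firstBin_eq_some_iff hφ, hz]
  rw [this, intervalI, uniformMeasure_real_Ico hρ (sumBefore_nonneg hφ l z)
    ((sumBefore_add_le hφ hz).trans hl), add_sub_cancel_left, max_eq_left (hφ z)]

theorem measureReal_secondBin (hφ : ∀ z, 0 ≤ φ z) {l : List Z} {ρ : ℝ} (hρ : 0 < ρ)
    (hl : (l.map φ).sum ≤ ρ) {z : Z} (hz : z ∈ l) :
    (uniformMeasure ρ).real {x | secondBin ρ φ l x = some z} = φ z / ρ := by
  have : {x | secondBin ρ φ l x = some z} = intervalJ ρ φ l z := by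
    ext x; simp [secondBin_eq_some_iff hφ hl, hz]
  rw [this, intervalJ]
  obtain _ | ⟨a, l⟩ := l
  · simp at hz
  have hle := sumBefore_add_le hφ hz
  have hnn := sumBefore_nonneg hφ (a :: l) z
  split_ifs with h
  · rw [uniformMeasure_real_Ico hρ (by linarith) le_rfl, sub_sub_cancel, max_eq_left (hφ z)]
  · have h' : z ≠ a := fun h' => h (by simp [h'])
    have hz' := (List.mem_cons.1 hz).resolve_left h'
    rw [List.map_cons, List.sum_cons] at hl
    rw [List.tail_cons, uniformMeasure_real_Ico hρ (sumBefore_nonneg hφ l z)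
      (by linarith [sumBefore_add_le hφ hz', hφ a]), add_sub_cancel_left, max_eq_left (hφ z)]

/-- For the head z₁ the intervals sit at opposite ends of [0, ρ] and overlap in length at most
(2φ(z₁) - ρ)⁺. For a later z the second interval is the first one shifted left by φ(z₁) ≥ φ(z),
hence disjoint from it. This is where the sorting matters. -/
theorem measureReal_firstBin_inter_secondBin_le (hφ : ∀ z, 0 ≤ φ z) {l : List Z} {ρ : ℝ}
    (hρ : 0 < ρ) (hl : (l.map φ).sum ≤ ρ) (hsort : l.Pairwise fun z w => φ w ≤ φ z) {z : Z}
    (hz : z ∈ l) :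
    (uniformMeasure ρ).real {x | firstBin φ l x = some z ∧ secondBin ρ φ l x = some z} ≤
      max (2 * φ z - ρ) 0 / ρ := by
  have : {x | firstBin φ l x = some z ∧ secondBin ρ φ l x = some z} =
      intervalI φ l z ∩ intervalJ ρ φ l z := by
    ext x; simp [firstBin_eq_some_iff hφ, secondBin_eq_some_iff hφ hl, hz]
  rw [this]
  obtain _ | ⟨a, l⟩ := l
  · simp at hz
  by_cases h : z = a
  · subst h
    have hle := sumBefore_add_le hφ hz
    rw [sumBefore_cons_self] at hle
    rw [intervalI, intervalJ, if_pos (by simp), sumBefore_cons_self, Set.Ico_inter_Ico]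
    refine (measureReal_mono (s₂ := Set.Ico (ρ - φ z) (φ z)) ?_).trans ?_
    · exact Set.Ico_subset_Ico le_sup_right (by rw [zero_add]; exact inf_le_left)
    · rw [uniformMeasure_real_Ico hρ (by linarith) (by linarith)]
      exact le_of_eq (by ring_nf)
  · have hz' := (List.mem_cons.1 hz).resolve_left h
    have hempty : intervalI φ (a :: l) z ∩ intervalJ ρ φ (a :: l) z = ∅ := by
      ext x
      simp only [Set.mem_inter_iff, Set.mem_empty_iff_false, iff_false, not_and]
      intro h1 h2
      rw [intervalJ, if_neg (by simpa using Ne.symm h)] at h2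
      rw [intervalI, sumBefore_cons_of_ne h] at h1
      have := (List.pairwise_cons.1 hsort).1 z hz'
      rw [List.tail_cons] at h2
      linarith [h1.1, h2.2]
    rw [hempty, measureReal_empty]
    positivity

theorem measurableSet_find? {A : Z → Set ℝ} (hA : ∀ z, MeasurableSet (A z))
    [∀ x : ℝ, DecidablePred fun z => x ∈ A z] (l : List Z) (o : Option Z) :
    MeasurableSet {x | (l.find? fun z => decide (x ∈ A z)) = o} := by
  induction l with
  | nil => simp
  | cons a l ih =>
    have : {x | ((a :: l).find? fun z => decide (x ∈ A z)) = o} =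
        (A a ∩ {_x | some a = o}) ∪ ((A a)ᶜ ∩ {x | (l.find? fun z => decide (x ∈ A z)) = o}) := by
      ext x
      by_cases h : x ∈ A a <;> simp [List.find?_cons, h]
    rw [this]
    exact ((hA a).inter (MeasurableSet.const _)).union ((hA a).compl.inter ih)

theorem measurableSet_firstBin_secondBin (ρ : ℝ) (φ : Z → ℝ) (l : List Z)
    (c : Option Z × Option Z) :
    MeasurableSet {x | (firstBin φ l x, secondBin ρ φ l x) = c} := by
  classical
  have : {x | (firstBin φ l x, secondBin ρ φ l x) = c} =
      {x | firstBin φ l x = c.1} ∩ {x | secondBin ρ φ l x = c.2} := by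
    ext x; simp [Prod.ext_iff]
  rw [this]
  refine (measurableSet_find? (A := intervalI φ l) (fun z => measurableSet_Ico) l c.1).inter
    (measurableSet_find? (A := intervalJ ρ φ l) (fun z => ?_) l c.2)
  unfold intervalJ
  split_ifs <;> exact measurableSet_Ico

end

end OnlineMatching

namespace OnlineMatching

open Finset

/-! ### The fractional matching of the offline optimum -/

section

variable {Y Z : Type*} {b : ℕ} {r : Y → ℝ} {Adj : Y → Z → Prop}
  {opt : (Fin b → Y) → Fin b → Option Z}

/-- With u = x/b, take the b-th power of 1 - u ≥ e^(-u)(1 - u²) and apply Bernoulli to (1 - u²)^b.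
-/
theorem exp_neg_sub_le_one_sub_div_pow {x : ℝ} (h0 : 0 ≤ x) (h2 : x ≤ 2) (hb : 2 ≤ b) :
    Real.exp (-x) - 4 / b ≤ (1 - x / b) ^ b := by
  have hb2 : (2 : ℝ) ≤ b := by exact_mod_cast hb
  have hb0 : (0 : ℝ) < b := by linarith
  set u := x / b with hu
  have hu0 : 0 ≤ u := by positivity
  have hu1 : u ≤ 1 := by rw [hu, div_le_one hb0]; linarith
  have h3 : Real.exp (-u) * (1 - u ^ 2) ≤ 1 - u := by
    have h4 : Real.exp (-u) * (1 + u) ≤ 1 := by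
      have : Real.exp (-u) * Real.exp u = 1 := by rw [← Real.exp_add]; simp
      rw [← this]
      gcongr
      linarith [Real.add_one_le_exp u]
    nlinarith
  have hu2 : u ^ 2 ≤ 1 := pow_le_one₀ hu0 hu1
  have h5 : 1 + (b : ℝ) * -u ^ 2 ≤ (1 + -u ^ 2) ^ b :=
    one_add_mul_le_pow (by linarith) b
  have h6 : Real.exp (-x) = Real.exp (-u) ^ b := by
    rw [← Real.exp_nat_mul, hu]; congr 1; field_simp
  have h7 : (b : ℝ) * u ^ 2 ≤ 4 / b := by
    rw [hu, div_pow, le_div_iff₀ hb0]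
    have : (b : ℝ) * (x ^ 2 / b ^ 2) * b = x ^ 2 := by field_simp
    rw [this]; nlinarith
  have h8 : Real.exp (-x) ≤ 1 := Real.exp_le_one_iff.2 (by linarith)
  have h9 := Real.exp_pos (-x)
  calc Real.exp (-x) - 4 / b ≤ Real.exp (-x) * (1 + (b : ℝ) * -u ^ 2) := by
        have : 0 ≤ (b : ℝ) * u ^ 2 := by positivity
        nlinarith
    _ ≤ Real.exp (-x) * (1 + -u ^ 2) ^ b := by gcongr
    _ = (Real.exp (-u) * (1 - u ^ 2)) ^ b := by rw [h6, mul_pow, sub_eq_add_neg]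
    _ ≤ _ := pow_le_pow_left₀ (mul_nonneg (Real.exp_pos _).le (by linarith)) h3 b

open Classical in
theorem sum_matched_le_count {ω : Fin b → Y} {M : Fin b → Option Z} (y : Y) (s : Finset Z) :
    ∑ z ∈ s, (if ∃ t, ω t = y ∧ M t = some z then (1 : ℝ) else 0) ≤
      ∑ t, if ω t = y then 1 else 0 := by
  calc ∑ z ∈ s, (if ∃ t, ω t = y ∧ M t = some z then (1 : ℝ) else 0)
      ≤ ∑ z ∈ s, ∑ t, if ω t = y ∧ M t = some z then 1 else 0 := by
        refine sum_le_sum fun z _ => ?_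
        split_ifs with h
        · obtain ⟨t, ht⟩ := h
          refine le_trans ?_ (single_le_sum (f := fun t =>
            if ω t = y ∧ M t = some z then (1 : ℝ) else 0)
            (fun t _ => by positivity) (mem_univ t))
          simp [ht]
        · exact sum_nonneg fun t _ => by positivity
    _ = ∑ t, ∑ z ∈ s, if ω t = y ∧ M t = some z then 1 else 0 := sum_comm
    _ ≤ _ := by
        refine sum_le_sum fun t _ => ?_
        by_cases h : ω t = y
        · rcases hM : M t with _ | w
          · simp [h]
          · simp only [h, Option.some.injEq, true_and, if_true]
            rw [sum_ite_eq]
            split_ifs <;> norm_num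
        · simp [h]

-- The bin z holds at most one ball, and none with type in A unless such a ball arrives. The product
-- is the indicator that none arrives, which has probability (1 - r(A)/b)^b.
open Classical in
theorem sum_matched_le {ω : Fin b → Y} {M : Fin b → Option Z} (hM : IsAllocation Adj ω M) (z : Z)
    (A : Finset Y) :
    ∑ y ∈ A, (if ∃ t, ω t = y ∧ M t = some z then (1 : ℝ) else 0) ≤
      1 - ∏ t, if ω t ∈ A then 0 else 1 := by
  by_cases h : ∃ t, M t = some z
  · obtain ⟨t, ht⟩ := h
    have hiff : ∀ y, (∃ s, ω s = y ∧ M s = some z) ↔ ω t = y := fun y =>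
      ⟨fun ⟨s, hs, hsz⟩ => hM.inj s t z hsz ht ▸ hs, fun h => ⟨t, h, ht⟩⟩
    simp_rw [hiff]
    rw [sum_ite_eq]
    split_ifs with hA
    · rw [prod_eq_zero (mem_univ t) (by simp [hA])]; simp
    · exact sub_nonneg.2 (prod_le_one (fun t _ => by positivity)
        fun t _ => by split_ifs <;> norm_num)
  · have : ∀ y, ¬ ∃ t, ω t = y ∧ M t = some z := fun y ⟨t, ht⟩ => h ⟨t, ht.2⟩
    simp only [this, if_false, sum_const_zero]
    exact sub_nonneg.2 (prod_le_one (fun t _ => by positivity)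
      fun t _ => by split_ifs <;> norm_num)

variable [Fintype Y]

theorem seqProb_nonneg (hr : ∀ y, 0 ≤ r y) (ω : Fin b → Y) : 0 ≤ seqProb r ω :=
  prod_nonneg fun _ _ => div_nonneg (hr _) (sum_nonneg fun y _ => hr y)

theorem sum_div_sum_eq_one (hb : 0 < b) (hsum : ∑ y, r y = b) : ∑ y, r y / ∑ y, r y = 1 := by
  have hb0 : (0 : ℝ) < b := by exact_mod_cast hb
  rw [← sum_div, hsum, div_self hb0.ne']

theorem sum_seqProb (hb : 0 < b) (hsum : ∑ y, r y = b) : ∑ ω : Fin b → Y, seqProb r ω = 1 :=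
  sum_prod_eq_one (sum_div_sum_eq_one hb hsum)

theorem fracMatching_nonneg (hr : ∀ y, 0 ≤ r y) (y : Y) (z : Z) : 0 ≤ fracMatching r opt y z := by
  classical
  exact sum_nonneg fun ω _ => mul_nonneg (seqProb_nonneg hr ω) (by split_ifs <;> norm_num)

open Classical in
theorem sum_seqProb_mul_count (hb : 0 < b) (hsum : ∑ y, r y = b) (y : Y) :
    ∑ ω : Fin b → Y, seqProb r ω * ∑ t, (if ω t = y then 1 else 0) = r y := by
  have hb0 : (0 : ℝ) < b := by exact_mod_cast hb
  have hone := sum_div_sum_eq_one hb hsum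
  have hs : ∀ s : Fin b,
      ∑ ω : Fin b → Y, seqProb r ω * (if ω s = y then 1 else 0) = r y / b := by
    intro s
    have h := sum_prod_mul_prod (n := b) (fun y => r y / ∑ y, r y)
      fun t x => if t = s then (if x = y then 1 else 0) else 1
    have hl : ∀ ω : Fin b → Y, (∏ t, if t = s then (if ω t = y then (1 : ℝ) else 0) else 1) =
        if ω s = y then 1 else 0 := fun ω => by
      rw [prod_eq_single s (fun t _ ht => by simp [ht]) (by simp)]; simp
    simp_rw [hl] at h
    refine h.trans ?_
    rw [prod_eq_single s (fun t _ ht => by simp [ht, hone]) (by simp)]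
    simp [hsum]
  simp_rw [mul_sum]
  rw [sum_comm]
  simp_rw [hs]
  simp [mul_div_cancel₀ _ hb0.ne']

theorem sum_fracMatching_le (hr : ∀ y, 0 ≤ r y) (hb : 0 < b) (hsum : ∑ y, r y = b) (y : Y)
    (s : Finset Z) : ∑ z ∈ s, fracMatching r opt y z ≤ r y := by
  classical
  unfold fracMatching
  rw [sum_comm]
  simp_rw [← mul_sum]
  refine le_trans (sum_le_sum fun ω _ => ?_) (sum_seqProb_mul_count hb hsum y).le
  exact mul_le_mul_of_nonneg_left (sum_matched_le_count y s) (seqProb_nonneg hr ω)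

theorem sum_fracMatching_le_one_sub_pow (hr : ∀ y, 0 ≤ r y) (hb : 0 < b) (hsum : ∑ y, r y = b)
    (hopt : ∀ ω, IsAllocation Adj ω (opt ω)) (z : Z) (A : Finset Y) :
    ∑ y ∈ A, fracMatching r opt y z ≤ 1 - (1 - (∑ y ∈ A, r y) / b) ^ b := by
  classical
  have hb0 : (0 : ℝ) < b := by exact_mod_cast hb
  have h := sum_prod_mul_prod (n := b) (fun y => r y / ∑ y, r y)
    fun _ x => if x ∈ A then 0 else 1
  have hA : ∑ y, (r y / ∑ y, r y) * (if y ∈ A then 0 else 1) = 1 - (∑ y ∈ A, r y) / b := by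
    have hone := sum_div_sum_eq_one hb hsum
    rw [hsum] at hone
    have hmem : ∑ y ∈ A, r y / (b : ℝ) = ∑ y, if y ∈ A then r y / (b : ℝ) else 0 := by simp
    rw [hsum, sum_div, eq_sub_iff_add_eq, hmem, ← sum_add_distrib]
    refine Eq.trans ?_ hone
    refine sum_congr rfl fun y _ => ?_
    split_ifs <;> simp
  rw [prod_const, card_univ, Fintype.card_fin, hA] at h
  unfold fracMatching
  rw [sum_comm, ← h, le_sub_iff_add_le, ← sum_add_distrib]
  refine le_trans (sum_le_sum fun ω _ => ?_) (sum_seqProb hb hsum).le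
  rw [← mul_sum]
  have := mul_le_mul_of_nonneg_left (sum_matched_le (hopt ω) z A) (seqProb_nonneg hr ω)
  rw [mul_sub, mul_one] at this
  exact le_sub_iff_add_le.1 this

theorem fracMatching_eq_zero (hopt : ∀ ω, IsAllocation Adj ω (opt ω)) {y : Y} {z : Z}
    (h : ¬ Adj y z) : fracMatching r opt y z = 0 := by
  classical
  refine sum_eq_zero fun ω _ => ?_
  rw [if_neg, mul_zero]
  rintro ⟨t, rfl, ht⟩
  exact h ((hopt ω).adj t z ht)

open Classical in
theorem sum_sum_matched [Fintype Z] {ω : Fin b → Y} {M : Fin b → Option Z}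
    (hM : IsAllocation Adj ω M) :
    ∑ z, ∑ y, (if ∃ t, ω t = y ∧ M t = some z then (1 : ℝ) else 0) = allocSize M := by
  have h1 : ∀ z y, (if ∃ t, ω t = y ∧ M t = some z then (1 : ℝ) else 0) =
      ∑ t, if ω t = y ∧ M t = some z then 1 else 0 := by
    intro z y
    split_ifs with h
    · obtain ⟨t, ht⟩ := h
      rw [sum_eq_single t (fun s _ hs => if_neg fun h => hs (hM.inj s t z h.2 ht.2)) (by simp),
        if_pos ht]
    · exact (sum_eq_zero fun t _ => if_neg fun ht => h ⟨t, ht⟩).symm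
  simp_rw [h1]
  rw [allocSize, card_eq_sum_ones, Nat.cast_sum, sum_filter]
  have h2 : ∀ t, ∑ z, ∑ y, (if ω t = y ∧ M t = some z then (1 : ℝ) else 0) =
      if (M t).isSome then ((1 : ℕ) : ℝ) else 0 := by
    intro t
    simp_rw [ite_and]
    rcases hM : M t with _ | w <;> simp
  calc _ = ∑ z, ∑ t, ∑ y, (if ω t = y ∧ M t = some z then (1 : ℝ) else 0) :=
        sum_congr rfl fun z _ => sum_comm
    _ = ∑ t, ∑ z, ∑ y, (if ω t = y ∧ M t = some z then (1 : ℝ) else 0) := sum_comm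
    _ = _ := sum_congr rfl fun t _ => h2 t

theorem sum_sum_fracMatching [Fintype Z] (hopt : ∀ ω, IsAllocation Adj ω (opt ω)) :
    ∑ z, ∑ y, fracMatching r opt y z = expectedOpt r opt := by
  classical
  unfold fracMatching expectedOpt
  simp_rw [fun z : Z => sum_comm (s := (univ : Finset Y)) (t := univ)
    (f := fun y ω => seqProb r ω * if ∃ t, ω t = y ∧ opt ω t = some z then (1 : ℝ) else 0)]
  rw [sum_comm]
  refine sum_congr rfl fun ω _ => ?_
  simp_rw [← mul_sum]
  rw [sum_sum_matched (hopt ω)]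

/-- Let R be the total rate of the types with nonnegative 2f - r. The sum is at most 2(1 - (1 -
R/b)^b) - R, which is about 2(1 - e^(-R)) - R, with maximum 1 - log 2 at R = log 2. -/
theorem sum_max_le (hr : ∀ y, 0 ≤ r y) (hb : 2 ≤ b) (hsum : ∑ y, r y = b)
    (hopt : ∀ ω, IsAllocation Adj ω (opt ω)) (z : Z) :
    ∑ y, max (2 * fracMatching r opt y z - r y) 0 ≤ 1 - Real.log 2 + 8 / b := by
  classical
  have hb2 : (2 : ℝ) ≤ b := by exact_mod_cast hb
  have hb0 : (0 : ℝ) < b := by linarith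
  set A := univ.filter fun y => 0 ≤ 2 * fracMatching r opt y z - r y with hA
  have h1 : ∑ y, max (2 * fracMatching r opt y z - r y) 0 =
      2 * ∑ y ∈ A, fracMatching r opt y z - ∑ y ∈ A, r y := by
    rw [mul_sum, ← sum_sub_distrib, hA, sum_filter]
    refine sum_congr rfl fun y _ => ?_
    split_ifs with h
    · exact max_eq_left h
    · exact max_eq_right (not_le.1 h).le
  rw [h1]
  have h2 := sum_fracMatching_le_one_sub_pow hr (by omega) hsum hopt z A
  set R := ∑ y ∈ A, r y with hR
  have hR0 : 0 ≤ R := sum_nonneg fun y _ => hr y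
  have hRb : R ≤ b := by
    rw [← hsum]; exact sum_le_univ_sum_of_nonneg hr
  have h8 : 0 ≤ 8 / (b : ℝ) := by positivity
  have hlog := Real.log_two_lt_d9
  rcases le_total R 2 with h | h
  · have h3 := exp_neg_sub_le_one_sub_div_pow hR0 h hb
    -- The tangent to 2e^(-R) at the maximiser R = log 2.
    have h4 : 1 + Real.log 2 - R ≤ 2 * Real.exp (-R) := by
      have h5 : 2 * Real.exp (-R) = Real.exp (Real.log 2 - R) := by
        rw [sub_eq_add_neg, Real.exp_add, Real.exp_log (by norm_num)]
      rw [h5]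
      linarith [Real.add_one_le_exp (Real.log 2 - R)]
    have h5 : 8 / (b : ℝ) = 2 * (4 / b) := by ring
    linarith
  · have h3 : 0 ≤ (1 - R / b) ^ b := by
      refine pow_nonneg (sub_nonneg.2 ?_) b
      rw [div_le_one hb0]; exact hRb
    norm_num at hlog
    linarith

end

end OnlineMatching

namespace OnlineMatching

open MeasureTheory Finset

/-! ### The law of the choices -/

section

variable {Y Z : Type*}

/-- The first and second choice of a ball of type `y` that draws the number `x`. -/
noncomputable def choice (r : Y → ℝ) (f : Y → Z → ℝ) (nbrs : Y → List Z) (y : Y) (x : ℝ) :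
    Option Z × Option Z :=
  (firstBin (f y) (nbrs y) x, secondBin (r y) (f y) (nbrs y) x)

theorem measurableSet_choice_preimage (r : Y → ℝ) (f : Y → Z → ℝ) (nbrs : Y → List Z) (y : Y)
    (c : Option Z × Option Z) : MeasurableSet (choice r f nbrs y ⁻¹' {c}) :=
  measurableSet_firstBin_secondBin (r y) (f y) (nbrs y) c

theorem sum_measureReal_choice [Fintype Z] (r : Y → ℝ) (f : Y → Z → ℝ) (nbrs : Y → List Z) (y : Y)
    (s : Finset (Option Z × Option Z)) :
    ∑ c ∈ s, (uniformMeasure (r y)).real (choice r f nbrs y ⁻¹' {c}) =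
      (uniformMeasure (r y)).real (choice r f nbrs y ⁻¹' s) :=
  sum_measureReal_preimage_singleton s fun c _ => measurableSet_choice_preimage r f nbrs y c

/-- The integrand depends on x only through finitely many choices, so it is constant on boxes, whose
product measure factorises. -/
theorem integral_choice [Fintype Z] {b : ℕ} (r : Y → ℝ) (f : Y → Z → ℝ) (nbrs : Y → List Z)
    (ω : Fin b → Y) (F : (Fin b → Option Z × Option Z) → ℝ) :
    ∫ x, F (fun t => choice r f nbrs (ω t) (x t)) ∂(Measure.pi fun t => uniformMeasure (r (ω t))) =
      ∑ c, F c * ∏ t, (uniformMeasure (r (ω t))).real (choice r f nbrs (ω t) ⁻¹' {c t}) := by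
  classical
  set A : (Fin b → Option Z × Option Z) → Set (Fin b → ℝ) := fun c =>
    Set.pi Set.univ fun t => choice r f nbrs (ω t) ⁻¹' {c t} with hA
  have hmeas : ∀ c, MeasurableSet (A c) := fun c =>
    MeasurableSet.univ_pi fun t => measurableSet_choice_preimage r f nbrs (ω t) (c t)
  have hF : ∀ x : Fin b → ℝ, F (fun t => choice r f nbrs (ω t) (x t)) =
      ∑ c, (A c).indicator (fun _ => F c) x := by
    intro x
    rw [sum_eq_single fun t => choice r f nbrs (ω t) (x t)]
    · rw [Set.indicator_of_mem]
      simp [hA]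
    · intro c _ hc
      refine Set.indicator_of_notMem (fun h => hc ?_) _
      funext t
      exact (h t (Set.mem_univ t)).symm
    · simp
  simp_rw [hF]
  rw [integral_finsetSum _ fun c _ => (integrable_const _).indicator (hmeas c)]
  refine sum_congr rfl fun c _ => ?_
  rw [integral_indicator_const _ (hmeas c), smul_eq_mul, mul_comm, measureReal_def,
    Measure.pi_pi, ENNReal.toReal_prod]
  rfl

variable [Fintype Y]

/-- The law of the choices of one ball. -/
noncomputable def choiceLaw (r : Y → ℝ) (f : Y → Z → ℝ) (nbrs : Y → List Z)
    (c : Option Z × Option Z) : ℝ :=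
  ∑ y, (r y / ∑ y, r y) * (uniformMeasure (r y)).real (choice r f nbrs y ⁻¹' {c})

theorem expectedAlg_eq [Fintype Z] (b : ℕ) (r : Y → ℝ) (f : Y → Z → ℝ) (nbrs : Y → List Z) :
    expectedAlg b r f nbrs =
      ∑ c : Fin b → Option Z × Option Z, (∏ t, choiceLaw r f nbrs (c t)) * (fullBins c b).card := by
  unfold expectedAlg
  have h : ∀ ω : Fin b → Y, ∫ x, (algSize r f nbrs ω x : ℝ)
      ∂(Measure.pi fun t => uniformMeasure (r (ω t))) = _ := fun ω =>
    integral_choice r f nbrs ω fun c => ((fullBins c b).card : ℝ)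
  simp_rw [h, mul_sum]
  rw [sum_comm]
  refine sum_congr rfl fun c _ => ?_
  unfold choiceLaw
  rw [← sum_prod_mul_prod, sum_mul]
  refine sum_congr rfl fun ω _ => ?_
  rw [seqProb]
  ring

theorem choiceLaw_nonneg {r : Y → ℝ} (hr : ∀ y, 0 ≤ r y) (f : Y → Z → ℝ) (nbrs : Y → List Z)
    (c : Option Z × Option Z) : 0 ≤ choiceLaw r f nbrs c :=
  sum_nonneg fun _ _ => mul_nonneg (div_nonneg (hr _) (sum_nonneg fun y _ => hr y))
    measureReal_nonneg

theorem mul_sum_choiceLaw [Fintype Z] {r : Y → ℝ} {b : ℕ} (hb : 0 < b) (hsum : ∑ y, r y = b)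
    (f : Y → Z → ℝ) (nbrs : Y → List Z) (s : Finset (Option Z × Option Z)) :
    b * ∑ c ∈ s, choiceLaw r f nbrs c =
      ∑ y, r y * (uniformMeasure (r y)).real (choice r f nbrs y ⁻¹' s) := by
  have hb0 : (0 : ℝ) < b := by exact_mod_cast hb
  unfold choiceLaw
  rw [sum_comm, mul_sum, hsum]
  refine sum_congr rfl fun y _ => ?_
  rw [← mul_sum, sum_measureReal_choice, ← mul_assoc, mul_div_cancel₀ _ hb0.ne']

theorem sum_choiceLaw [Fintype Z] {r : Y → ℝ} (hr : ∀ y, 0 ≤ r y) {b : ℕ} (hb : 0 < b)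
    (hsum : ∑ y, r y = b) (f : Y → Z → ℝ) (nbrs : Y → List Z) :
    ∑ c, choiceLaw r f nbrs c = 1 := by
  have hb0 : (0 : ℝ) < b := by exact_mod_cast hb
  have h := mul_sum_choiceLaw hb hsum f nbrs univ
  have h2 : ∑ y, r y * (uniformMeasure (r y)).real
      (choice r f nbrs y ⁻¹' ((univ : Finset (Option Z × Option Z)) : Set (Option Z × Option Z))) =
        b := by
    rw [← hsum]
    refine sum_congr rfl fun y _ => ?_
    rcases (hr y).eq_or_lt with h | h
    · rw [← h, zero_mul]
    · have := uniformMeasure_real_Ico h le_rfl le_rfl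
      rw [sub_zero, max_eq_left h.le, div_self h.ne'] at this
      have hle : (1 : ℝ) ≤ (uniformMeasure (r y)).real
          (choice r f nbrs y ⁻¹'
            ((univ : Finset (Option Z × Option Z)) : Set (Option Z × Option Z))) := by
        rw [← this]; exact measureReal_mono (by simp)
      rw [le_antisymm measureReal_le_one hle, mul_one]
  rw [h2] at h
  exact mul_left_cancel₀ hb0.ne' (h.trans (mul_one _).symm)

end

/-! ### Marginals and diagonal of the law of the choices -/

section

variable {Y Z : Type*} [Fintype Y] {b : ℕ} {r : Y → ℝ} {Adj : Y → Z → Prop}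
  {opt : (Fin b → Y) → Fin b → Option Z} {nbrs : Y → List Z}

theorem sum_map_fracMatching_le (hr : ∀ y, 0 ≤ r y) (hb : 0 < b) (hsum : ∑ y, r y = b) {y : Y}
    (hnd : (nbrs y).Nodup) : ((nbrs y).map (fracMatching r opt y)).sum ≤ r y := by
  classical
  rw [← List.sum_toFinset _ hnd]
  exact sum_fracMatching_le hr hb hsum y _

theorem mul_measureReal_eq (hr : ∀ y, 0 ≤ r y) (hb : 0 < b) (hsum : ∑ y, r y = b)
    (hopt : ∀ ω, IsAllocation Adj ω (opt ω)) {y : Y} (hmem : ∀ z, z ∈ nbrs y ↔ Adj y z) {z : Z}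
    {s : Set ℝ} (hnot : z ∉ nbrs y → s = ∅)
    (hs : 0 < r y → z ∈ nbrs y → (uniformMeasure (r y)).real s = fracMatching r opt y z / r y) :
    r y * (uniformMeasure (r y)).real s = fracMatching r opt y z := by
  by_cases hz : z ∈ nbrs y
  · rcases (hr y).eq_or_lt with h | h
    -- If r y = 0, then f_(y,z) ≤ r y forces both sides to vanish.
    · have h1 := sum_fracMatching_le (opt := opt) hr hb hsum y {z}
      rw [sum_singleton, ← h] at h1
      rw [← h, zero_mul]
      exact le_antisymm (fracMatching_nonneg hr y z) h1
    · rw [hs h hz, mul_div_cancel₀ _ h.ne']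
  · rw [hnot hz, measureReal_empty, mul_zero,
      fracMatching_eq_zero hopt fun h => hz ((hmem z).2 h)]

theorem sum_fracMatching_bin_le_one (hr : ∀ y, 0 ≤ r y) (hb : 0 < b) (hsum : ∑ y, r y = b)
    (hopt : ∀ ω, IsAllocation Adj ω (opt ω)) (z : Z) : ∑ y, fracMatching r opt y z ≤ 1 := by
  have hb0 : (0 : ℝ) < b := by exact_mod_cast hb
  have := sum_fracMatching_le_one_sub_pow hr hb hsum hopt z univ
  rwa [hsum, div_self hb0.ne', sub_self, zero_pow hb.ne', sub_zero] at this

variable [Fintype Z]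

theorem mul_firstProb_choiceLaw (hr : ∀ y, 0 ≤ r y) (hb : 0 < b) (hsum : ∑ y, r y = b)
    (hopt : ∀ ω, IsAllocation Adj ω (opt ω))
    (hn : ∀ y, IsDecreasingListing (Adj y) (fracMatching r opt y) (nbrs y)) (z : Z) :
    b * firstProb (choiceLaw r (fracMatching r opt) nbrs) z = ∑ y, fracMatching r opt y z := by
  classical
  have h := mul_sum_choiceLaw hb hsum (fracMatching r opt) nbrs ({some z} ×ˢ univ)
  rw [sum_product, sum_singleton] at h
  rw [firstProb_eq_sum, h]
  refine sum_congr rfl fun y _ => ?_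
  have hset : choice r (fracMatching r opt) nbrs y ⁻¹'
      (({some z} ×ˢ univ : Finset (Option Z × Option Z)) : Set (Option Z × Option Z)) =
      {x | firstBin (fracMatching r opt y) (nbrs y) x = some z} := by
    ext x; simp [choice, eq_comm]
  rw [hset]
  refine mul_measureReal_eq hr hb hsum hopt (hn y).mem_iff (fun hz => ?_) fun h hz =>
    measureReal_firstBin (fracMatching_nonneg hr y) h
      (sum_map_fracMatching_le hr hb hsum (hn y).nodup) hz
  ext x
  simp [firstBin_eq_some_iff (fracMatching_nonneg hr y), hz]

theorem mul_sum_choiceLaw_second (hr : ∀ y, 0 ≤ r y) (hb : 0 < b) (hsum : ∑ y, r y = b)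
    (hopt : ∀ ω, IsAllocation Adj ω (opt ω))
    (hn : ∀ y, IsDecreasingListing (Adj y) (fracMatching r opt y) (nbrs y)) (z : Z) :
    b * ∑ o, choiceLaw r (fracMatching r opt) nbrs (o, some z) = ∑ y, fracMatching r opt y z := by
  classical
  have h := mul_sum_choiceLaw hb hsum (fracMatching r opt) nbrs (univ ×ˢ {some z})
  simp_rw [sum_product, sum_singleton] at h
  rw [h]
  refine sum_congr rfl fun y _ => ?_
  have hset : choice r (fracMatching r opt) nbrs y ⁻¹'
      ((univ ×ˢ {some z} : Finset (Option Z × Option Z)) : Set (Option Z × Option Z)) =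
      {x | secondBin (r y) (fracMatching r opt y) (nbrs y) x = some z} := by
    ext x; simp [choice, eq_comm]
  rw [hset]
  have hl := sum_map_fracMatching_le (opt := opt) hr hb hsum (hn y).nodup
  refine mul_measureReal_eq hr hb hsum hopt (hn y).mem_iff (fun hz => ?_) fun h hz =>
    measureReal_secondBin (fracMatching_nonneg hr y) h hl hz
  ext x
  simp [secondBin_eq_some_iff (fracMatching_nonneg hr y) hl, hz]

theorem mul_choiceLaw_diag_le (hr : ∀ y, 0 ≤ r y) (hb : 2 ≤ b) (hsum : ∑ y, r y = b)
    (hopt : ∀ ω, IsAllocation Adj ω (opt ω))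
    (hn : ∀ y, IsDecreasingListing (Adj y) (fracMatching r opt y) (nbrs y)) (z : Z) :
    b * choiceLaw r (fracMatching r opt) nbrs (some z, some z) ≤ 1 - Real.log 2 + 8 / b := by
  classical
  have hb' : 0 < b := by omega
  refine le_trans ?_ (sum_max_le hr hb hsum hopt z)
  have h := mul_sum_choiceLaw hb' hsum (fracMatching r opt) nbrs {(some z, some z)}
  rw [sum_singleton] at h
  rw [h]
  refine sum_le_sum fun y _ => ?_
  have hset : choice r (fracMatching r opt) nbrs y ⁻¹'
      (({(some z, some z)} : Finset (Option Z × Option Z)) : Set (Option Z × Option Z)) =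
      {x | firstBin (fracMatching r opt y) (nbrs y) x = some z ∧
        secondBin (r y) (fracMatching r opt y) (nbrs y) x = some z} := by
    ext x; simp [choice]
  rw [hset]
  rcases (hr y).eq_or_lt with h0 | h0
  · rw [← h0, zero_mul]
    exact le_max_right _ _
  by_cases hz : z ∈ nbrs y
  · have := measureReal_firstBin_inter_secondBin_le (fracMatching_nonneg hr y) h0
      (sum_map_fracMatching_le hr hb' hsum (hn y).nodup) (hn y).sorted hz
    rwa [le_div_iff₀ h0, mul_comm] at this
  · have : {x | firstBin (fracMatching r opt y) (nbrs y) x = some z ∧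
        secondBin (r y) (fracMatching r opt y) (nbrs y) x = some z} = ∅ := by
      ext x
      simp [firstBin_eq_some_iff (fracMatching_nonneg hr y), hz]
    rw [this, measureReal_empty, mul_zero]
    exact le_max_right _ _

end

end OnlineMatching

open OnlineMatching
theorem mainTheorem1 :
    ∃ b₀ : ℕ, ∀ b : ℕ, b₀ ≤ b →
      ∀ (Y : Type*) (Z : Type*) [Fintype Y] [Fintype Z] (Adj : Y → Z → Prop) (r : Y → ℝ)
        (opt : (Fin b → Y) → Fin b → Option Z) (nbrs : Y → List Z),
        (∀ y, 0 ≤ r y) →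
        ∑ y, r y = b →
        (∀ ω, IsMaxAllocation Adj ω (opt ω)) →
        (∀ y, IsDecreasingListing (Adj y) (fracMatching r opt y) (nbrs y)) →
        0 < expectedOpt r opt →
        0.702 ≤ competitiveRatio r opt nbrs := by
  -- The value 10⁵ makes the errors of order 1/b smaller than the margin 0.0003.
  refine ⟨10 ^ 5, fun b hb Y Z _ _ Adj r opt nbrs hr hsum hmax hn hpos => ?_⟩
  have hb0 : 0 < b := by omega
  have hopt := fun ω => (hmax ω).isAllocation
  rw [competitiveRatio, le_div_iff₀ hpos, expectedAlg_eq, ← sum_sum_fracMatching hopt]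
  exact le_sum_mul_card_fullBins (choiceLaw_nonneg hr _ _) (sum_choiceLaw hr hb0 hsum _ _) hb
    (fun z => mul_firstProb_choiceLaw hr hb0 hsum hopt hn z)
    (fun z => sum_fracMatching_bin_le_one hr hb0 hsum hopt z)
    (fun z => mul_sum_choiceLaw_second hr hb0 hsum hopt hn z)
    fun z => mul_choiceLaw_diag_le hr (by omega) hsum hopt hn z
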